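/- Consider the LTI plant $\dot x = Ax+Bu+B_ww$, $z = Cx+Du+D_ww$ with $x\in\mathbb R^n$, $u\in\mathbb R^m$, $z\in\mathbb R^r$, constant disturbance $w\in\mathcal W\subseteq\mathbb R^{n_w}$ and $A$ Hurwitz, and let $G_u=-CA^{-1}B+D$, $G_w=-CA^{-1}B_w+D_w$. For $w\in\mathcal W$ consider the problem $$\min_{\bar z\in\mathcal Z,\ \bar u\in\mathcal U}\ f_0(\bar u)+g_0(\bar z)\quad\text{subject to}\quad \bar z=G_u\bar u+G_ww,\quad 0=H_z\bar z+H_u\bar u+H_ww,\qquad(\ast)$$ with $n_{\rm c}$ engineering constraints, where $\mathcal U\subseteq\mathbb R^m$, $\mathcal Z\subseteq\mathbb R^r$ are convex sets, $f_0:\mathcal U\to\mathbb R$ and $g_0:\mathcal Z\to\mathbb R$ are convex, and on the interiors of their domains continuously differentiable with locally Lipschitz gradients; $\mathcal W$ is convex and compact, and for every $w\in\mathcal W$ problem $(\ast)$ has an optimal solution with $\bar u\in\operatorname{int}\mathcal U$ and $\bar z\in\operatorname{int}\mathcal Z$. Let $T=\begin{bmatrix}T_z\\T_u\end{bmatrix}\in\mathbb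 R^{(r+m)\times q}$ have full column rank and satisfy $\operatorname{range}T=\operatorname{null}\begin{bmatrix}I_r&-G_u\\H_z&H_u\end{bmatrix}$, let $N=H_zG_u+H_u$ have full row rank, and for each $w\in\mathcal W$ let $(z_0(w),u_0(w))$ satisfy the two affine constraints of $(\ast)$. Assume that for each $w\in\mathcal W$ the function $\xi\mapsto f_0(T_u\xi+u_0(w))+g_0(T_z\xi+z_0(w))$ is strongly convex on $\Xi_w=\{\xi\in\mathbb R^q : T_u\xi+u_0(w)\in\mathcal U,\ T_z\xi+z_0(w)\in\mathcal Z\}$. Then: (i) there is a matrix $K_2\in\mathbb R^{m\times n_{\rm c}}$ such that $-NK_2$ is Hurwitz; (ii) for every $K_2$ with $-NK_2$ Hurwitz and every symmetric $P\succ0$ in $\mathbb R^{q\times q}$, there is a matrix $K_1\in\mathbb R^{m\times q}$ of full column rank with $\Pi_{\rm c}K_1=T_uP$, where $\Pi_{\rm c}=I_m-K_2(NK_2)^{-1}N$; (iii) for every such choice of $K_2,P,K_1$ there are $\tau^\star>0$ and $\rho>0$ such that for all $\tau_2>\tau^\star$ and all $\tau_1>\rho\,\tau_2$ the controller $$\tau_1\dot\eta_1=-T_u^{\mathsf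 T}\nabla f_0(u)-T_z^{\mathsf T}\nabla g_0(z),\qquad \tau_2\dot\eta_2=-(H_zz+H_uu+H_ww),\qquad u=K_1\eta_1+K_2\eta_2$$ solves the optimal steady-state control problem: for each $w\in\mathcal W$, the closed-loop system with state $(x,\eta_1,\eta_2)$, on the set of states where $u\in\operatorname{int}\mathcal U$ and $z\in\operatorname{int}\mathcal Z$, has exactly one equilibrium point, this equilibrium is locally exponentially stable, and the equilibrium values $(\bar z,\bar u)$ of output and input are an optimal point of $(\ast)$. -/

import Mathlib

open Matrix

/-- Real column vectors of length `k`, with the Euclidean norm and inner product. -/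
abbrev Vec (k : ℕ) : Type := EuclideanSpace ℝ (Fin k)

/-- The matrix-vector product on Euclidean spaces. -/
noncomputable abbrev matAct {a b : ℕ} (M : Matrix (Fin a) (Fin b) ℝ) (v : Vec b) : Vec a :=
  Matrix.toEuclideanLin M v

infixr:73 " *ₑ " => matAct

/-- A real square matrix is Hurwitz if all its complex eigenvalues have negative real part. -/
def IsHurwitz {k : ℕ} (M : Matrix (Fin k) (Fin k) ℝ) : Prop :=
  ∀ s ∈ spectrum ℂ (M.map (algebraMap ℝ ℂ)), s.re < 0

/-! ### Ordinary differential equations on an open domain -/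

section ODE

variable {E : Type*} [NormedAddCommGroup E] [NormedSpace ℝ E]

/-- `φ` is a (forward complete) solution of `ẋ = F x` on `[0, ∞)` with values in `Ω`. -/
def IsSolution (F : E → E) (Ω : Set E) (φ : ℝ → E) : Prop :=
  ∀ t, 0 ≤ t → φ t ∈ Ω ∧ HasDerivWithinAt φ (F (φ t)) (Set.Ici 0) t

/-- `p` is an equilibrium point, in the domain `Ω`, of `ẋ = F x`. -/
def IsEquilibrium (F : E → E) (Ω : Set E) (p : E) : Prop :=
  p ∈ Ω ∧ F p = 0

/-- Local exponential stability of the point `p` for `ẋ = F x` on `Ω`: from every initial state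
near `p` there is a solution on `[0, ∞)`, and every such solution converges to `p` exponentially,
with uniform constants. -/
def IsLocallyExpStable (F : E → E) (Ω : Set E) (p : E) : Prop :=
  ∃ δ > 0, ∃ c > 0, ∃ rate > 0, ∀ x₀ : E, ‖x₀ - p‖ < δ →
    (∃ φ, IsSolution F Ω φ ∧ φ 0 = x₀) ∧
    ∀ φ, IsSolution F Ω φ → φ 0 = x₀ →
      ∀ t : ℝ, 0 ≤ t → ‖φ t - p‖ ≤ c * Real.exp (-rate * t) * ‖x₀ - p‖

end ODE

/-! ### Plant and steady-state optimization problem -/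

/-- The matrices of the LTI plant `ẋ = A x + B u + B_w w`, `z = C x + D u + D_w w`. -/
structure Plant (n m r nw : ℕ) where
  A : Matrix (Fin n) (Fin n) ℝ
  B : Matrix (Fin n) (Fin m) ℝ
  Bw : Matrix (Fin n) (Fin nw) ℝ
  C : Matrix (Fin r) (Fin n) ℝ
  D : Matrix (Fin r) (Fin m) ℝ
  Dw : Matrix (Fin r) (Fin nw) ℝ

namespace Plant

variable {n m r nw : ℕ} (S : Plant n m r nw)

/-- DC gain from the input `u` to the output `z`. -/
noncomputable def Gu : Matrix (Fin r) (Fin m) ℝ := -(S.C * S.A⁻¹ * S.B) + S.D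

/-- DC gain from the disturbance `w` to the output `z`. -/
noncomputable def Gw : Matrix (Fin r) (Fin nw) ℝ := -(S.C * S.A⁻¹ * S.Bw) + S.Dw

end Plant

/-- Data of the steady-state optimization problem other than the plant: the domains `U`, `Z` of
the objective functions `f₀`, `g₀` (whose values outside the domains are irrelevant), the set `W`
of disturbances, and the matrices of the engineering constraint
`0 = H_z z + H_u u + H_w w`. -/
structure OSSData (m r nw nc : ℕ) where
  U : Set (Vec m)
  Z : Set (Vec r)
  W : Set (Vec nw)
  f₀ : Vec m → ℝ
  g₀ : Vec r → ℝ
  Hz : Matrix (Fin nc) (Fin r) ℝ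
  Hu : Matrix (Fin nc) (Fin m) ℝ
  Hw : Matrix (Fin nc) (Fin nw) ℝ

/-- The two affine constraints `z = G_u u + G_w w` and `0 = H_z z + H_u u + H_w w`. -/
def SteadyStateConstraints {n m r nw nc : ℕ} (S : Plant n m r nw) (O : OSSData m r nw nc)
    (w : Vec nw) (z : Vec r) (u : Vec m) : Prop :=
  z = S.Gu *ₑ u + S.Gw *ₑ w ∧ 0 = O.Hz *ₑ z + O.Hu *ₑ u + O.Hw *ₑ w

/-- `(z, u)` is feasible for the steady-state optimization problem with disturbance `w`. -/
def IsFeasible {n m r nw nc : ℕ} (S : Plant n m r nw) (O : OSSData m r nw nc)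
    (w : Vec nw) (z : Vec r) (u : Vec m) : Prop :=
  z ∈ O.Z ∧ u ∈ O.U ∧ SteadyStateConstraints S O w z u

/-- `(z, u)` is an optimal point: it minimizes `f₀ u + g₀ z` among the feasible points. -/
def IsOptimal {n m r nw nc : ℕ} (S : Plant n m r nw) (O : OSSData m r nw nc)
    (w : Vec nw) (z : Vec r) (u : Vec m) : Prop :=
  IsFeasible S O w z u ∧
    ∀ z' u', IsFeasible S O w z' u' → O.f₀ u + O.g₀ z ≤ O.f₀ u' + O.g₀ z'

/-- Standing assumptions on the problem data. The gradients of `f₀`, `g₀` are available only on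
the interiors of the domains, so the optimal solution is taken in the interiors (which contains
strict feasibility). Closedness of `U` and `Z` is not required, so that domains of barrier
functions are covered too. -/
structure StandingAssumptions {n m r nw nc : ℕ} (S : Plant n m r nw)
    (O : OSSData m r nw nc) : Prop where
  convexOn_f₀ : ConvexOn ℝ O.U O.f₀
  convexOn_g₀ : ConvexOn ℝ O.Z O.g₀
  contDiffOn_f₀ : ContDiffOn ℝ 1 O.f₀ (interior O.U)
  contDiffOn_g₀ : ContDiffOn ℝ 1 O.g₀ (interior O.Z)
  locallyLipschitz_grad_f₀ : LocallyLipschitzOn (interior O.U) (gradient O.f₀)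
  locallyLipschitz_grad_g₀ : LocallyLipschitzOn (interior O.Z) (gradient O.g₀)
  convex_W : Convex ℝ O.W
  isCompact_W : IsCompact O.W
  exists_optimal : ∀ w ∈ O.W, ∃ z ∈ interior O.Z, ∃ u ∈ interior O.U, IsOptimal S O w z u

/-- The matrix `N = H_z G_u + H_u`. -/
noncomputable def constraintGain {n m r nw nc : ℕ} (S : Plant n m r nw) (O : OSSData m r nw nc) :
    Matrix (Fin nc) (Fin m) ℝ :=
  O.Hz * S.Gu + O.Hu

/-- `range [T_z; T_u] = null [I, -G_u; H_z, H_u]`. -/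
def SpansFeasibleSubspace {n m r nw nc q : ℕ} (S : Plant n m r nw) (O : OSSData m r nw nc)
    (Tz : Matrix (Fin r) (Fin q) ℝ) (Tu : Matrix (Fin m) (Fin q) ℝ) : Prop :=
  LinearMap.range (Matrix.fromRows Tz Tu).mulVecLin =
    LinearMap.ker (Matrix.fromBlocks 1 (-S.Gu) O.Hz O.Hu).mulVecLin

/-- The matrix `Π_c = I - K₂ (N K₂)⁻¹ N`. -/
noncomputable def projC {m nc : ℕ} (N : Matrix (Fin nc) (Fin m) ℝ)
    (K₂ : Matrix (Fin m) (Fin nc) ℝ) : Matrix (Fin m) (Fin m) ℝ :=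
  1 - K₂ * (N * K₂)⁻¹ * N

/-! ### The closed loop with the two-loop integral controller

The state is `(x, η₁, η₂)`. -/

section ClosedLoop

variable {n m r nw nc q : ℕ} (S : Plant n m r nw) (O : OSSData m r nw nc)
  (Tz : Matrix (Fin r) (Fin q) ℝ) (Tu : Matrix (Fin m) (Fin q) ℝ)
  (K₁ : Matrix (Fin m) (Fin q) ℝ) (K₂ : Matrix (Fin m) (Fin nc) ℝ) (τ₁ τ₂ : ℝ) (w : Vec nw)

/-- The control input `u = K₁ η₁ + K₂ η₂`. -/
noncomputable def clInput (s : Vec n × Vec q × Vec nc) : Vec m :=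
  K₁ *ₑ s.2.1 + K₂ *ₑ s.2.2

/-- The plant output `z = C x + D u + D_w w`. -/
noncomputable def clOutput (s : Vec n × Vec q × Vec nc) : Vec r :=
  S.C *ₑ s.1 + S.D *ₑ clInput K₁ K₂ s + S.Dw *ₑ w

/-- The states at which the closed-loop vector field is defined: those where the gradients of
`f₀` and `g₀` exist. -/
def clDomain : Set (Vec n × Vec q × Vec nc) :=
  {s | clInput K₁ K₂ s ∈ interior O.U ∧ clOutput S K₁ K₂ w s ∈ interior O.Z}

/-- The closed-loop vector field:
`ẋ = A x + B u + B_w w`, `τ₁ η̇₁ = -(T_uᵀ ∇f₀(u) + T_zᵀ ∇g₀(z))`,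
`τ₂ η̇₂ = -(H_z z + H_u u + H_w w)`. -/
noncomputable def clField (s : Vec n × Vec q × Vec nc) : Vec n × Vec q × Vec nc :=
  (S.A *ₑ s.1 + S.B *ₑ clInput K₁ K₂ s + S.Bw *ₑ w,
   -(τ₁⁻¹ • (Tuᵀ *ₑ gradient O.f₀ (clInput K₁ K₂ s) +
      Tzᵀ *ₑ gradient O.g₀ (clOutput S K₁ K₂ w s))),
   -(τ₂⁻¹ • (O.Hz *ₑ clOutput S K₁ K₂ w s + O.Hu *ₑ clInput K₁ K₂ s + O.Hw *ₑ w)))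

/-- The two-loop controller with these gains and time constants solves the optimal steady-state
control problem: for each disturbance in `W`, the closed loop has exactly one equilibrium point,
this point is locally exponentially stable, and the equilibrium values of output and input are an
optimal point of the steady-state optimization problem. -/
def SolvesOSS : Prop :=
  ∀ w ∈ O.W, ∃ p : Vec n × Vec q × Vec nc,
    IsEquilibrium (clField S O Tz Tu K₁ K₂ τ₁ τ₂ w) (clDomain S O K₁ K₂ w) p ∧
    (∀ p', IsEquilibrium (clField S O Tz Tu K₁ K₂ τ₁ τ₂ w) (clDomain S O K₁ K₂ w) p' → p' = p) ∧
    IsLocallyExpStable (clField S O Tz Tu K₁ K₂ τ₁ τ₂ w) (clDomain S O K₁ K₂ w) p ∧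
    IsOptimal S O w (clOutput S K₁ K₂ w p) (clInput K₁ K₂ p)

end ClosedLoop

/-! The closed loop is a three-time-scale system: the plant is fast, `η₂` intermediate, `η₁` slow.
Write `M = (N K₂)⁻¹ N K₁` and measure deviations from an equilibrium by `ξ = P η₁`, `a = η₂ + M η₁`
and `b = x + A⁻¹ B u`. The relation `Π_c K₁ = T_u P` says exactly that `u = T_u ξ + K₂ a`
(`gain_splitting`). So when `a = b = 0` the input and output move inside the feasible affine
subspace and `ξ` follows the gradient flow, preconditioned by `P`, of the reduced objective `Φ`.
Since `N T_u = 0`, the equation for `η₂` sees only `a` and `b`, and `a` is driven by `-N K₂`.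

The Lyapunov function is `Φ(ξ) - Φ(0) + ⟨Q₂ a, a⟩ + ⟨Q₃ b, b⟩`, with `Q₂`, `Q₃` from the Hurwitz
matrices `-N K₂` and `A` (`IsHurwitz.exists_lyapunov_form`). Young's inequality absorbs all
couplings once `τ₂` and `τ₁ / τ₂` are large (`three_timescale_dissipation`).

The thresholds must not depend on `w`. Slow dissipation is therefore measured by the reduced
gradient rather than by `ξ`, so the strong convexity constant, which may vary with `w`, stays out of
them; only a Lipschitz constant of the gradients enters. It can be chosen uniformly because
optimizers depend continuously on `w` and `W` is compact
(`StandingAssumptions.exists_uniform_lipschitz`).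

Equilibria in the domain are the feasible critical points of the reduced objective. Strong convexity
leaves one such point, the optimum, and the map `(η₁, η₂) ↦ u` is bijective, so the equilibrium
state is unique too. -/

/-! ### Exponential stability from a Lyapunov function -/

open Set Filter Topology Metric NNReal in
theorem exists_forall_hasDerivWithinAt_of_lipschitz_of_bounded {E : Type*} [NormedAddCommGroup E]
    [NormedSpace ℝ E] [CompleteSpace E] {G : E → E} {K : ℝ≥0} (hG : LipschitzWith K G)
    {M : ℝ≥0} (hM : ∀ x, ‖G x‖ ≤ M) (x₀ : E) :
    ∃ φ : ℝ → E, φ 0 = x₀ ∧ ∀ t, 0 ≤ t → HasDerivWithinAt φ (G (φ t)) (Ici 0) t := by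
  have hex : ∀ n : ℕ, ∃ α : ℝ → E, α 0 = x₀ ∧
      ∀ t ∈ Icc (0 : ℝ) n, HasDerivWithinAt α (G (α t)) (Icc (0 : ℝ) n) t := by
    intro n
    have h0 : (0 : ℝ) ∈ Icc (0 : ℝ) n := ⟨le_rfl, n.cast_nonneg⟩
    -- Speed at most `M` keeps a solution within distance `M * n` up to time `n`, so that radius
    -- suffices.
    have : IsPicardLindelof (fun _ => G) (⟨0, h0⟩ : Icc (0 : ℝ) n) x₀ (M * n) 0 M K :=
      { lipschitzOnWith := fun _ _ => hG.lipschitzOnWith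
        continuousOn := fun _ _ => continuousOn_const
        norm_le := fun _ _ x _ => hM x
        mul_max_le := by simp }
    exact this.exists_eq_forall_mem_Icc_hasDerivWithinAt₀
  choose α hα0 hα using hex
  have hIci : ∀ n : ℕ, ∀ t ∈ Ico (0 : ℝ) n, HasDerivWithinAt (α n) (G (α n t)) (Ici 0) t := by
    intro n t ht
    refine (hα n t ⟨ht.1, ht.2.le⟩).mono_of_mem_nhdsWithin ?_
    rw [← Ici_inter_Iic]
    exact inter_mem self_mem_nhdsWithin (mem_nhdsWithin_of_mem_nhds (Iic_mem_nhds ht.2))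
  have hagree : ∀ m n : ℕ, m ≤ n → EqOn (α m) (α n) (Icc (0 : ℝ) m) := by
    intro m n hmn
    have hmn' : (m : ℝ) ≤ n := by exact_mod_cast hmn
    have hsub : Icc (0 : ℝ) m ⊆ Icc (0 : ℝ) n := Icc_subset_Icc_right hmn'
    refine ODE_solution_unique (v := fun _ => G) (K := K) (fun _ => hG)
      (fun t ht => (hα m t ht).continuousWithinAt)
      (fun t ht => (hIci m t ht).mono (Ici_subset_Ici.2 ht.1))
      (fun t ht => ((hα n t (hsub ht)).continuousWithinAt).mono hsub)
      (fun t ht => (hIci n t ⟨ht.1, ht.2.trans_le hmn'⟩).mono (Ici_subset_Ici.2 ht.1))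
      (by rw [hα0, hα0])
  -- The index `⌈t⌉₊ + 1` puts `t` strictly below the right endpoint, where the derivative within
  -- `Icc` is one within `Ici 0`.
  refine ⟨fun t => α (⌈t⌉₊ + 1) t, hα0 _, fun t ht => ?_⟩
  have key : ∀ n : ℕ, ∀ s ∈ Icc (0 : ℝ) n, α (⌈s⌉₊ + 1) s = α n s := by
    intro n s hs
    rcases le_total (⌈s⌉₊ + 1) n with h | h
    · refine hagree _ _ h ⟨hs.1, ?_⟩
      push_cast
      linarith [Nat.le_ceil s]
    · exact (hagree _ _ h hs).symm
  have htlt : t < ((⌈t⌉₊ + 1 : ℕ) : ℝ) := by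
    push_cast
    linarith [Nat.le_ceil t]
  refine (hIci (⌈t⌉₊ + 1) t ⟨ht, htlt⟩).congr_of_eventuallyEq ?_ rfl
  filter_upwards [self_mem_nhdsWithin, mem_nhdsWithin_of_mem_nhds (Iio_mem_nhds htlt)] with s hs hs'
  exact key _ s ⟨hs, le_of_lt hs'⟩

-- After a Lipschitz extension, each coordinate is clipped to `[-b, b]`; clipping is 1-Lipschitz and
-- changes nothing on `s`. The resulting field has solutions for all forward times.
open Set Metric NNReal in
theorem LipschitzOnWith.exists_lipschitz_bounded_extension {E : Type*} [NormedAddCommGroup E]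
    [NormedSpace ℝ E] [FiniteDimensional ℝ E] {F : E → E} {s : Set E} {K : ℝ≥0}
    (hF : LipschitzOnWith K F s) {M : ℝ} (hM : ∀ x ∈ s, ‖F x‖ ≤ M) :
    ∃ (G : E → E) (K' M' : ℝ≥0), LipschitzWith K' G ∧ (∀ x, ‖G x‖ ≤ M') ∧ EqOn F G s := by
  obtain ⟨g, hg, hFg⟩ := hF.extend_finite_dimension
  let e : E ≃L[ℝ] (Fin (Module.finrank ℝ E) → ℝ) :=
    ContinuousLinearEquiv.ofFinrankEq (by simp)
  let b : ℝ := max 0 (‖(e : E →L[ℝ] (Fin (Module.finrank ℝ E) → ℝ))‖ * M)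
  have hb : 0 ≤ b := le_max_left _ _
  let c : (Fin (Module.finrank ℝ E) → ℝ) → (Fin (Module.finrank ℝ E) → ℝ) :=
    fun v i => max (-b) (min b (v i))
  have hc : LipschitzWith 1 c := by
    refine LipschitzWith.of_dist_le_mul fun v w => ?_
    rw [NNReal.coe_one, one_mul]
    refine (dist_pi_le_iff dist_nonneg).2 fun i => ?_
    refine le_trans ?_ (dist_le_pi_dist v w i)
    have h1 : LipschitzWith 1 (fun x : ℝ => max (-b) (min b x)) :=
      (LipschitzWith.id.const_min b).const_max (-b)
    simpa using h1.dist_le_mul (v i) (w i)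
  have hcb : ∀ v, ‖c v‖ ≤ b := fun v => (pi_norm_le_iff_of_nonneg hb).2 fun i => by
    rw [Real.norm_eq_abs, abs_le]
    exact ⟨le_max_left _ _, max_le (by linarith) (min_le_left _ _)⟩
  refine ⟨fun x => e.symm (c (e (g x))), _, ‖(e.symm : (Fin (Module.finrank ℝ E) → ℝ) →L[ℝ] E)‖₊ * b.toNNReal,
    (e.symm : (Fin (Module.finrank ℝ E) → ℝ) →L[ℝ] E).lipschitz.comp (hc.comp ((e : E →L[ℝ] (Fin (Module.finrank ℝ E) → ℝ)).lipschitz.comp hg)), ?_, ?_⟩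
  · intro x
    refine ((e.symm : (Fin (Module.finrank ℝ E) → ℝ) →L[ℝ] E).le_opNorm _).trans ?_
    rw [NNReal.coe_mul, Real.coe_toNNReal _ hb]
    exact mul_le_mul_of_nonneg_left (hcb _) (norm_nonneg _)
  · intro x hx
    have hv : ∀ i, |e (g x) i| ≤ b := fun i => by
      rw [← Real.norm_eq_abs]
      refine (norm_le_pi_norm _ i).trans ?_
      refine ((e : E →L[ℝ] (Fin (Module.finrank ℝ E) → ℝ)).le_opNorm _).trans ((mul_le_mul_of_nonneg_left ?_
        (norm_nonneg _)).trans (le_max_right _ _))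
      rw [← hFg hx]
      exact hM x hx
    have : c (e (g x)) = e (g x) := by
      funext i
      have := abs_le.1 (hv i)
      simp only [c]
      rw [min_eq_right this.2, max_eq_right this.1]
    simp only [this, e.symm_apply_apply]
    exact hFg hx

-- While `φ` stays in the ball, `exp (c₃ / c₂ * t) * V (φ t)` is nonincreasing; a first exit time
-- would contradict the resulting bound. The equation is required only inside the ball, so the lemma
-- also applies to solutions of a field that merely agrees with `F` there.
open Set Filter Topology Metric in
theorem norm_sub_le_exp_of_lyapunov {E : Type*} [NormedAddCommGroup E] [NormedSpace ℝ E]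
    {F : E → E} {p : E} {R : ℝ} {V : E → ℝ} {V' : E → E →L[ℝ] ℝ} {c₁ c₂ c₃ : ℝ}
    (hc₁ : 0 < c₁) (hc₂ : 0 < c₂) (hc₃ : 0 < c₃)
    (hV : ∀ x ∈ ball p R, HasFDerivAt V (V' x) x)
    (hlow : ∀ x ∈ ball p R, c₁ * ‖x - p‖ ^ 2 ≤ V x)
    (hup : ∀ x ∈ ball p R, V x ≤ c₂ * ‖x - p‖ ^ 2)
    (hdec : ∀ x ∈ ball p R, V' x (F x) ≤ -c₃ * ‖x - p‖ ^ 2)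
    {φ : ℝ → E}
    (hφ : ∀ t, 0 ≤ t → φ t ∈ ball p R → HasDerivWithinAt φ (F (φ t)) (Ici 0) t)
    (hcont : ContinuousOn φ (Ici 0))
    (h0 : √(c₂ / c₁) * ‖φ 0 - p‖ < R) (h0' : ‖φ 0 - p‖ < R) {t : ℝ} (ht : 0 ≤ t) :
    φ t ∈ ball p R ∧
      ‖φ t - p‖ ≤ √(c₂ / c₁) * Real.exp (-(c₃ / (2 * c₂)) * t) * ‖φ 0 - p‖ := by
  have hdecay : ∀ T, 0 ≤ T → (∀ t ∈ Icc 0 T, φ t ∈ ball p R) →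
      ‖φ T - p‖ ≤ √(c₂ / c₁) * Real.exp (-(c₃ / (2 * c₂)) * T) * ‖φ 0 - p‖ := by
    intro T hT hmem
    have hα : c₃ / c₂ * c₂ = c₃ := by field_simp
    have hder : ∀ t ∈ Icc 0 T, HasDerivWithinAt (fun t => Real.exp (c₃ / c₂ * t) * V (φ t))
        (Real.exp (c₃ / c₂ * t) * (c₃ / c₂) * V (φ t) +
          Real.exp (c₃ / c₂ * t) * V' (φ t) (F (φ t))) (Ici 0) t := by
      intro t ht
      have h1 : HasDerivAt (fun t => Real.exp (c₃ / c₂ * t))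
          (Real.exp (c₃ / c₂ * t) * (c₃ / c₂)) t := by
        simpa using ((hasDerivAt_id t).const_mul (c₃ / c₂)).exp
      exact h1.hasDerivWithinAt.mul
        ((hV _ (hmem t ht)).comp_hasDerivWithinAt t (hφ t ht.1 (hmem t ht)))
    have hanti : AntitoneOn (fun t => Real.exp (c₃ / c₂ * t) * V (φ t)) (Icc 0 T) := by
      refine antitoneOn_of_hasDerivWithinAt_nonpos (convex_Icc 0 T)
        (fun t ht => ((hder t ht).continuousWithinAt).mono Icc_subset_Ici_self)
        (fun t ht => (hder t (interior_subset ht)).mono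
          (interior_subset.trans Icc_subset_Ici_self)) fun t ht => ?_
      have hm := hmem t (interior_subset ht)
      have h1 := hdec _ hm
      have h2 := mul_le_mul_of_nonneg_left (hup _ hm) (div_pos hc₃ hc₂).le
      rw [← mul_assoc, hα] at h2
      have h3 : 0 < Real.exp (c₃ / c₂ * t) := Real.exp_pos _
      have : Real.exp (c₃ / c₂ * t) * (c₃ / c₂ * V (φ t) + V' (φ t) (F (φ t))) ≤ 0 :=
        mul_nonpos_of_nonneg_of_nonpos h3.le (by linarith)
      linarith
    have hT0 := hanti ⟨le_rfl, hT⟩ ⟨hT, le_rfl⟩ hT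
    simp only [mul_zero, Real.exp_zero, one_mul] at hT0
    have h1 := hlow _ (hmem T ⟨hT, le_rfl⟩)
    have h2 := hup _ (hmem 0 ⟨le_rfl, hT⟩)
    have hexp : Real.exp (c₃ / c₂ * T) * (Real.exp (-(c₃ / (2 * c₂)) * T)) ^ 2 = 1 := by
      rw [sq, ← Real.exp_add, ← Real.exp_add, ← Real.exp_zero]
      congr 1
      field_simp
      ring
    refine abs_le_of_sq_le_sq' ?_ (by positivity) |>.2
    rw [mul_pow, mul_pow, Real.sq_sqrt (by positivity)]
    set X := Real.exp (c₃ / c₂ * T)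
    set Y := (Real.exp (-(c₃ / (2 * c₂)) * T)) ^ 2
    have hX : 0 < X := Real.exp_pos _
    have hY : 0 ≤ Y := sq_nonneg _
    have h3 : X * (c₁ * ‖φ T - p‖ ^ 2) ≤ c₂ * ‖φ 0 - p‖ ^ 2 :=
      ((mul_le_mul_of_nonneg_left h1 hX.le).trans hT0).trans h2
    have h4 := mul_le_mul_of_nonneg_left h3 hY
    have h5 : Y * (X * (c₁ * ‖φ T - p‖ ^ 2)) = c₁ * ‖φ T - p‖ ^ 2 := by
      linear_combination c₁ * ‖φ T - p‖ ^ 2 * hexp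
    rw [h5] at h4
    rw [show c₂ / c₁ * Y * ‖φ 0 - p‖ ^ 2 = Y * (c₂ * ‖φ 0 - p‖ ^ 2) / c₁ by ring,
      le_div_iff₀ hc₁]
    linarith
  have hstay : ∀ t, 0 ≤ t → φ t ∈ ball p R := by
    by_contra! hcon
    obtain ⟨t₁, ht₁, hφt₁⟩ := hcon
    -- Its infimum `T` is the first exit time; the decay bound holds before `T` and passes to the
    -- limit at `T`.
    let S : Set ℝ := Ici 0 ∩ φ ⁻¹' (ball p R)ᶜ
    have hScl : IsClosed S := hcont.preimage_isClosed_of_isClosed isClosed_Ici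
      isOpen_ball.isClosed_compl
    have hSbdd : BddBelow S := ⟨0, fun t ht => ht.1⟩
    have hTS : sInf S ∈ S := hScl.csInf_mem ⟨t₁, ht₁, hφt₁⟩ hSbdd
    set T := sInf S
    have hlt : ∀ t, 0 ≤ t → t < T → φ t ∈ ball p R := by
      intro t ht htT
      by_contra h
      exact absurd (csInf_le hSbdd ⟨ht, h⟩) (not_le.2 htT)
    have hT0 : 0 < T := by
      rcases (show (0 : ℝ) ≤ T from hTS.1).eq_or_lt with h | h
      · exact absurd (mem_ball_iff_norm.2 h0') (by rw [h]; exact hTS.2)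
      · exact h
    have hlim : Tendsto (fun t => ‖φ t - p‖) (𝓝[Ico 0 T] T) (𝓝 ‖φ T - p‖) :=
      (((hcont T hTS.1).mono Ico_subset_Ici_self).sub continuousWithinAt_const).norm
    have : (𝓝[Ico 0 T] T).NeBot := by
      rw [nhdsWithin_Ico_eq_nhdsLT hT0]
      infer_instance
    have hle : ‖φ T - p‖ ≤ √(c₂ / c₁) * ‖φ 0 - p‖ := by
      refine le_of_tendsto hlim ?_
      filter_upwards [self_mem_nhdsWithin] with t ht
      refine (hdecay t ht.1 fun s hs => hlt s hs.1 (hs.2.trans_lt ht.2)).trans ?_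
      refine mul_le_mul_of_nonneg_right (mul_le_of_le_one_right (Real.sqrt_nonneg _) ?_)
        (norm_nonneg _)
      rw [Real.exp_le_one_iff, neg_mul, neg_nonpos]
      exact mul_nonneg (by positivity) ht.1
    exact hTS.2 (mem_ball_iff_norm.2 (hle.trans_lt h0))
  exact ⟨hstay t ht, hdecay t ht fun s hs => hstay s hs.1⟩

-- Existence comes from a bounded Lipschitz extension of `F`: its solution never leaves the ball,
-- where the two fields agree.
open Set Filter Topology Metric NNReal in
theorem isLocallyExpStable_of_lyapunov {E : Type*} [NormedAddCommGroup E] [NormedSpace ℝ E]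
    [FiniteDimensional ℝ E] {F : E → E} {Ω : Set E} {p : E} {R : ℝ} (hR : 0 < R)
    (hΩ : ball p R ⊆ Ω) {K : ℝ≥0} (hF : LipschitzOnWith K F (ball p R))
    {V : E → ℝ} {V' : E → E →L[ℝ] ℝ} {c₁ c₂ c₃ : ℝ}
    (hc₁ : 0 < c₁) (hc₂ : 0 < c₂) (hc₃ : 0 < c₃)
    (hV : ∀ x ∈ ball p R, HasFDerivAt V (V' x) x)
    (hlow : ∀ x ∈ ball p R, c₁ * ‖x - p‖ ^ 2 ≤ V x)
    (hup : ∀ x ∈ ball p R, V x ≤ c₂ * ‖x - p‖ ^ 2)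
    (hdec : ∀ x ∈ ball p R, V' x (F x) ≤ -c₃ * ‖x - p‖ ^ 2) :
    IsLocallyExpStable F Ω p := by
  have hs : 0 ≤ √(c₂ / c₁) := Real.sqrt_nonneg _
  have hs1 : 0 < √(c₂ / c₁) + 1 := by linarith
  refine ⟨R / (√(c₂ / c₁) + 1), by positivity, √(c₂ / c₁), by positivity, c₃ / (2 * c₂),
    by positivity, fun x₀ hx₀ => ?_⟩
  rw [lt_div_iff₀ hs1] at hx₀
  have hn := norm_nonneg (x₀ - p)
  have h0 : √(c₂ / c₁) * ‖x₀ - p‖ < R := by nlinarith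
  have h0' : ‖x₀ - p‖ < R := by nlinarith
  constructor
  · have hp : p ∈ ball p R := mem_ball_self hR
    have hM : ∀ x ∈ ball p R, ‖F x‖ ≤ ‖F p‖ + K * R := by
      intro x hx
      have h1 := hF.dist_le_mul x hx p hp
      rw [dist_eq_norm] at h1
      have h2 : ‖F x‖ ≤ ‖F p‖ + ‖F x - F p‖ := norm_le_insert' _ _
      have h3 : (K : ℝ) * dist x p ≤ K * R :=
        mul_le_mul_of_nonneg_left (mem_ball.1 hx).le K.2
      linarith
    obtain ⟨G, K', M', hG, hGM, hFG⟩ := hF.exists_lipschitz_bounded_extension hM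
    obtain ⟨φ, hφ0, hφ⟩ := exists_forall_hasDerivWithinAt_of_lipschitz_of_bounded hG hGM x₀
    subst hφ0
    have hmem : ∀ t, 0 ≤ t → φ t ∈ ball p R := fun t ht =>
      (norm_sub_le_exp_of_lyapunov hc₁ hc₂ hc₃ hV hlow hup hdec
        (fun t ht h => by rw [hFG h]; exact hφ t ht)
        (fun t ht => (hφ t ht).continuousWithinAt) h0 h0' ht).1
    refine ⟨φ, fun t ht => ⟨hΩ (hmem t ht), ?_⟩, rfl⟩
    rw [hFG (hmem t ht)]
    exact hφ t ht
  · rintro φ hφ rfl t ht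
    exact (norm_sub_le_exp_of_lyapunov hc₁ hc₂ hc₃ hV hlow hup hdec
      (fun t ht _ => (hφ t ht).2)
      (fun t ht => (hφ t ht).2.continuousWithinAt) h0 h0' ht).2

/-! ### Quadratic Lyapunov functions of Hurwitz matrices -/

theorem LinearMap.exists_norm_le_mul {E F : Type*} [NormedAddCommGroup E] [NormedSpace ℝ E]
    [FiniteDimensional ℝ E] [NormedAddCommGroup F] [NormedSpace ℝ F] (L : E →ₗ[ℝ] F) :
    ∃ C, 0 ≤ C ∧ ∀ x, ‖L x‖ ≤ C * ‖x‖ :=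
  ⟨‖LinearMap.toContinuousLinearMap L‖, norm_nonneg _,
    fun x => (LinearMap.toContinuousLinearMap L).le_opNorm x⟩

section
attribute [local instance] Matrix.linftyOpNormedRing Matrix.linftyOpNormedAlgebra

-- Gelfand's formula, with `r` strictly between the spectral radius and 1.
open Filter Topology NNReal ENNReal in
theorem spectrum.exists_eventually_norm_pow_le {A : Type*} [NormedRing A] [NormedAlgebra ℂ A]
    [CompleteSpace A] {a : A} (ha : ∀ s ∈ spectrum ℂ a, ‖s‖ < 1) :
    ∃ r : ℝ, 0 ≤ r ∧ r < 1 ∧ ∀ᶠ n : ℕ in atTop, ‖a ^ n‖ ≤ r ^ n := by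
  have hlt : spectralRadius ℂ a < 1 := by
    rcases (spectrum ℂ a).eq_empty_or_nonempty with h | h
    · simp [spectralRadius, h]
    · exact_mod_cast spectrum.spectralRadius_lt_of_forall_lt_of_nonempty h (r := 1)
        fun k hk => by exact_mod_cast ha k hk
  obtain ⟨r, hr, hr1⟩ := ENNReal.lt_iff_exists_nnreal_btwn.1 hlt
  refine ⟨r, r.2, by exact_mod_cast hr1, ?_⟩
  filter_upwards [(spectrum.pow_nnnorm_pow_one_div_tendsto_nhds_spectralRadius a).eventually
    (gt_mem_nhds hr), eventually_gt_atTop 0] with n hn hn0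
  have h1 : ((‖a ^ n‖₊ : ℝ≥0∞) ^ (1 / n : ℝ)) ^ n ≤ (r : ℝ≥0∞) ^ n := by gcongr
  rw [one_div, ENNReal.rpow_inv_natCast_pow hn0.ne'] at h1
  have h2 : ‖a ^ n‖₊ ≤ r ^ n := by exact_mod_cast h1
  exact_mod_cast h2

open Filter Topology in
/-- Powers of a real matrix whose complex spectrum lies in the open unit disc are square
summable. -/
theorem Matrix.summable_norm_toEuclideanCLM_pow_sq {k : ℕ} (T : Matrix (Fin k) (Fin k) ℝ)
    (hT : ∀ s ∈ spectrum ℂ (T.map (algebraMap ℝ ℂ)), ‖s‖ < 1) :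
    Summable fun j : ℕ => ‖(Matrix.toEuclideanCLM (n := Fin k) (𝕜 := ℝ) T) ^ j‖ ^ 2 := by
  obtain ⟨r, hr0, hr1, hr⟩ := spectrum.exists_eventually_norm_pow_le hT
  obtain ⟨C, hC, hL⟩ := LinearMap.exists_norm_le_mul
    ((Matrix.toEuclideanCLM (n := Fin k) (𝕜 := ℝ)).toAlgEquiv.toLinearMap)
  -- Complexification preserves the row-sum norm, so the complex estimate is one on real matrices;
  -- `C` then passes to the Euclidean operator norm.
  have hmap : ∀ X : Matrix (Fin k) (Fin k) ℝ, ‖X.map (algebraMap ℝ ℂ)‖ = ‖X‖ := by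
    intro X
    simp [Matrix.linfty_opNorm_def, Matrix.map_apply]
  refine Summable.of_norm_bounded_eventually_nat (g := fun j => C ^ 2 * (r ^ 2) ^ j)
    ((summable_geometric_of_lt_one (by positivity) (by nlinarith)).mul_left _) ?_
  filter_upwards [hr] with j hj
  have h1 : (T.map (algebraMap ℝ ℂ)) ^ j = (T ^ j).map (algebraMap ℝ ℂ) :=
    (map_pow (algebraMap ℝ ℂ).mapMatrix T j).symm
  rw [h1, hmap] at hj
  rw [← map_pow, Real.norm_of_nonneg (sq_nonneg _), pow_right_comm, ← mul_pow]
  gcongr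
  exact (hL _).trans (mul_le_mul_of_nonneg_left hj hC)

end

-- `Q = ∑ (T ^ j)* T ^ j`: the term `j = 0` gives the lower bound, and shifting the index gives the
-- Stein equation `T* Q T = Q - 1`.
open ContinuousLinearMap in
theorem ContinuousLinearMap.exists_stein_form {H : Type*} [NormedAddCommGroup H]
    [InnerProductSpace ℝ H] [CompleteSpace H] (T : H →L[ℝ] H)
    (hT : Summable fun j : ℕ => ‖T ^ j‖ ^ 2) :
    ∃ Q : H →L[ℝ] H, (∀ v v', inner ℝ (Q v) v' = inner ℝ v (Q v')) ∧
      (∀ v, ‖v‖ ^ 2 ≤ inner ℝ (Q v) v) ∧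
      ∀ v, inner ℝ (Q (T v)) (T v) = inner ℝ (Q v) v - ‖v‖ ^ 2 := by
  have hs : Summable fun j : ℕ => adjoint (T ^ j) ∘L (T ^ j) := by
    refine Summable.of_norm_bounded hT fun j => ?_
    refine (opNorm_comp_le _ _).trans ?_
    rw [LinearIsometryEquiv.norm_map, sq]
  have hsum : ∀ v v', HasSum (fun j => inner ℝ ((T ^ j) v) ((T ^ j) v'))
      (inner ℝ ((∑' j : ℕ, adjoint (T ^ j) ∘L (T ^ j)) v) v') := by
    intro v v'
    have h1 := (hs.hasSum.mapL (ContinuousLinearMap.apply ℝ H v)).mapL (innerSL ℝ v')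
    simp only [ContinuousLinearMap.apply_apply, innerSL_apply_apply] at h1
    have h2 : ∀ j, inner ℝ v' ((adjoint (T ^ j) ∘L (T ^ j)) v) =
        inner ℝ ((T ^ j) v) ((T ^ j) v') := fun j => by
      rw [ContinuousLinearMap.comp_apply, adjoint_inner_right, real_inner_comm]
    simp only [h2] at h1
    rw [real_inner_comm]
    exact h1
  refine ⟨∑' j : ℕ, adjoint (T ^ j) ∘L (T ^ j), fun v v' => ?_, fun v => ?_, fun v => ?_⟩
  · rw [real_inner_comm _ v]
    refine (hsum v v').unique ?_
    convert hsum v' v using 2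
    exact real_inner_comm _ _
  · have := le_hasSum (hsum v v) 0 fun j _ => real_inner_self_nonneg
    simpa using this
  · have h1 := (hasSum_nat_add_iff' 1).2 (hsum v v)
    refine (hsum (T v) (T v)).unique ?_
    simpa [pow_succ] using h1

theorem IsHurwitz.isUnit_algebraMap_sub {k : ℕ} {M : Matrix (Fin k) (Fin k) ℝ}
    (hM : IsHurwitz M) {s : ℂ} (hs : 0 ≤ s.re) :
    IsUnit (algebraMap ℂ (Matrix (Fin k) (Fin k) ℂ) s - M.map (algebraMap ℝ ℂ)) := by
  by_contra h
  exact absurd (hM s (spectrum.mem_iff.2 h)) (not_lt.2 hs)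

theorem Matrix.isUnit_of_isUnit_map {k : ℕ} {M : Matrix (Fin k) (Fin k) ℝ}
    (h : IsUnit (M.map (algebraMap ℝ ℂ))) : IsUnit M := by
  rw [Matrix.isUnit_iff_isUnit_det, isUnit_iff_ne_zero] at h ⊢
  intro h0
  apply h
  have := RingHom.map_det (algebraMap ℝ ℂ) M
  rw [h0, map_zero] at this
  exact this.symm

theorem IsHurwitz.isUnit_smul_one_sub {k : ℕ} {M : Matrix (Fin k) (Fin k) ℝ} (hM : IsHurwitz M)
    {c : ℝ} (hc : 0 ≤ c) : IsUnit (c • (1 : Matrix (Fin k) (Fin k) ℝ) - M) := by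
  apply Matrix.isUnit_of_isUnit_map
  convert hM.isUnit_algebraMap_sub (s := c) (by simpa using hc) using 1
  ext i j
  by_cases h : i = j <;> simp [Matrix.algebraMap_matrix_apply, h]

theorem IsHurwitz.isUnit_one_sub {k : ℕ} {M : Matrix (Fin k) (Fin k) ℝ} (hM : IsHurwitz M) :
    IsUnit (1 - M) := by
  simpa using hM.isUnit_smul_one_sub zero_le_one

theorem IsHurwitz.isUnit {k : ℕ} {M : Matrix (Fin k) (Fin k) ℝ} (hM : IsHurwitz M) :
    IsUnit M := by
  simpa using (hM.isUnit_smul_one_sub le_rfl).neg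

/-- The Cayley transform carries the open left half-plane to the open unit disc: `(s - S)(1 - M) =
(s - 1) - (s + 1) M`, and `‖s‖ ≥ 1` means that `(s - 1) / (s + 1)` has nonnegative real part. The
value `s = -1` leaves the invertible scalar `-2`. -/
theorem IsHurwitz.norm_lt_one_of_mem_spectrum_cayley {k : ℕ} {M S : Matrix (Fin k) (Fin k) ℝ}
    (hM : IsHurwitz M) (hS : S * (1 - M) = 1 + M) :
    ∀ s ∈ spectrum ℂ (S.map (algebraMap ℝ ℂ)), ‖s‖ < 1 := by
  intro s hs
  by_contra! h1
  rw [spectrum.mem_iff] at hs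
  apply hs
  have hS' : S.map (algebraMap ℝ ℂ) * (1 - M.map (algebraMap ℝ ℂ)) =
      1 + M.map (algebraMap ℝ ℂ) := by
    have := congrArg (algebraMap ℝ ℂ).mapMatrix hS
    simpa only [map_mul, map_sub, map_add, map_one, RingHom.mapMatrix_apply] using this
  set Mc := M.map (algebraMap ℝ ℂ)
  set Sc := S.map (algebraMap ℝ ℂ)
  have hu : IsUnit (1 - Mc) := by
    simpa only [map_one] using hM.isUnit_algebraMap_sub (s := 1) (by simp)
  have hprod : (algebraMap ℂ _ s - Sc) * (1 - Mc) =
      algebraMap ℂ _ (s - 1) - algebraMap ℂ _ (s + 1) * Mc := by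
    rw [sub_mul, hS']
    simp only [map_sub, map_add, map_one]
    noncomm_ring
  have hprodu : IsUnit ((algebraMap ℂ (Matrix (Fin k) (Fin k) ℂ) s - Sc) * (1 - Mc)) := by
    rw [hprod]
    by_cases hs1 : s + 1 = 0
    · rw [hs1, map_zero, zero_mul, sub_zero]
      refine (isUnit_iff_ne_zero.2 fun h => ?_).map _
      have : (2 : ℂ) = 0 := by linear_combination hs1 - h
      norm_num at this
    · have h2 : algebraMap ℂ (Matrix (Fin k) (Fin k) ℂ) (s - 1) - algebraMap ℂ _ (s + 1) * Mc =
          algebraMap ℂ _ (s + 1) * (algebraMap ℂ _ ((s - 1) / (s + 1)) - Mc) := by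
        rw [mul_sub, ← map_mul, mul_div_cancel₀ _ hs1]
      rw [h2]
      refine ((isUnit_iff_ne_zero.2 hs1).map _).mul (hM.isUnit_algebraMap_sub ?_)
      rw [Complex.div_re, ← add_div]
      refine div_nonneg ?_ (Complex.normSq_nonneg _)
      have h3 : 1 ≤ s.re * s.re + s.im * s.im := by
        rw [← Complex.normSq_apply, Complex.normSq_eq_norm_sq]
        nlinarith
      simp
      nlinarith
  exact (hu.mul_right_iff).1 hprodu

/-- A Hurwitz matrix admits a quadratic Lyapunov function. -/
theorem IsHurwitz.exists_lyapunov_form {k : ℕ} {M : Matrix (Fin k) (Fin k) ℝ}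
    (hM : IsHurwitz M) :
    ∃ Q : Vec k →L[ℝ] Vec k, (∀ v v', inner ℝ (Q v) v' = inner ℝ v (Q v')) ∧
      (∃ c > 0, ∀ v, c * ‖v‖ ^ 2 ≤ inner ℝ (Q v) v) ∧
      ∀ v, 2 * inner ℝ (Q v) (M *ₑ v) ≤ - ‖v‖ ^ 2 := by
  have hu := hM.isUnit_one_sub
  have hud := (Matrix.isUnit_iff_isUnit_det _).1 hu
  have hS : (1 + M) * (1 - M)⁻¹ * (1 - M) = 1 + M := by
    rw [Matrix.mul_assoc, Matrix.nonsing_inv_mul _ hud, Matrix.mul_one]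
  -- For the Cayley transform, the Stein equation at `(1 - M) v` compares `Q` on `v + M v` and `v -
  -- M v`; their difference is `4 ⟨Q v, M v⟩`.
  obtain ⟨Q, hsymm, hpos, hstein⟩ := ContinuousLinearMap.exists_stein_form _
    (Matrix.summable_norm_toEuclideanCLM_pow_sq _ (hM.norm_lt_one_of_mem_spectrum_cayley hS))
  let I : Vec k →L[ℝ] Vec k := Matrix.toEuclideanCLM (n := Fin k) (𝕜 := ℝ) (1 - M)⁻¹
  let J : Vec k →L[ℝ] Vec k := Matrix.toEuclideanCLM (n := Fin k) (𝕜 := ℝ) (1 - M)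
  let Mc : Vec k →L[ℝ] Vec k := Matrix.toEuclideanCLM (n := Fin k) (𝕜 := ℝ) M
  have hJ : ∀ v, J v = v - Mc v := fun v => by simp [J, Mc]
  have hIJ : ∀ v, I (J v) = v := fun v => by
    rw [← mul_apply_eq_comp, ← map_mul, Matrix.nonsing_inv_mul _ hud, map_one,
      one_apply_eq_self]
  have hSJ : ∀ v, Matrix.toEuclideanCLM (n := Fin k) (𝕜 := ℝ) ((1 + M) * (1 - M)⁻¹) (J v) =
      v + Mc v := fun v => by
    rw [← mul_apply_eq_comp, ← map_mul, hS]
    simp [Mc]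
  have hB : 0 < ‖I‖ + 1 := by positivity
  have hlow : ∀ v, ‖v‖ ≤ (‖I‖ + 1) * ‖J v‖ := fun v => by
    have := I.le_opNorm (J v)
    rw [hIJ] at this
    nlinarith [norm_nonneg (J v)]
  -- The factor turns the decrease `-‖(1 - M) v‖ ^ 2` into `-‖v‖ ^ 2`.
  refine ⟨(2 * (‖I‖ + 1) ^ 2) • Q, fun v v' => ?_, ⟨2 * (‖I‖ + 1) ^ 2, by positivity,
    fun v => ?_⟩, fun v => ?_⟩
  · simp only [_root_.smul_apply, inner_smul_left, inner_smul_right, hsymm]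
    simp
  · simp only [_root_.smul_apply, inner_smul_left]
    exact mul_le_mul_of_nonneg_left (hpos v) (by positivity)
  · have h1 := hstein (J v)
    rw [hSJ] at h1
    have h2 : 4 * inner ℝ (Q v) (Mc v) = - ‖J v‖ ^ 2 := by
      rw [hJ v] at h1 ⊢
      simp only [map_add, map_sub, inner_add_left, inner_add_right, inner_sub_left,
        inner_sub_right] at h1
      have h3 : inner ℝ (Q (Mc v)) v = inner ℝ (Q v) (Mc v) := by
        rw [hsymm, real_inner_comm]
      rw [h3] at h1
      linarith
    have h4 : M *ₑ v = Mc v := rfl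
    rw [h4]
    simp only [_root_.smul_apply, inner_smul_left]
    have h5 : ‖v‖ ^ 2 ≤ (‖I‖ + 1) ^ 2 * ‖J v‖ ^ 2 := by
      rw [← mul_pow]
      gcongr
      exact hlow v
    simp
    nlinarith

/-! ### Matrices acting on Euclidean vectors -/

theorem matAct_mul {a b c : ℕ} (M : Matrix (Fin a) (Fin b) ℝ) (N : Matrix (Fin b) (Fin c) ℝ)
    (v : Vec c) : (M * N) *ₑ v = M *ₑ (N *ₑ v) := by
  simp [matAct, Matrix.toLpLin_apply, Matrix.mulVec_mulVec]

theorem matAct_add_matrix {a b : ℕ} (M N : Matrix (Fin a) (Fin b) ℝ) (v : Vec b) :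
    (M + N) *ₑ v = M *ₑ v + N *ₑ v := by
  simp [matAct]

theorem matAct_sub_matrix {a b : ℕ} (M N : Matrix (Fin a) (Fin b) ℝ) (v : Vec b) :
    (M - N) *ₑ v = M *ₑ v - N *ₑ v := by
  simp [matAct]

theorem matAct_neg_matrix {a b : ℕ} (M : Matrix (Fin a) (Fin b) ℝ) (v : Vec b) :
    (-M) *ₑ v = -(M *ₑ v) := by
  simp [matAct]

theorem matAct_one {a : ℕ} (v : Vec a) : (1 : Matrix (Fin a) (Fin a) ℝ) *ₑ v = v := by
  simp [matAct]

theorem matAct_add {a b : ℕ} (M : Matrix (Fin a) (Fin b) ℝ) (v v' : Vec b) :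
    M *ₑ (v + v') = M *ₑ v + M *ₑ v' := map_add (Matrix.toEuclideanLin M) v v'

theorem matAct_sub {a b : ℕ} (M : Matrix (Fin a) (Fin b) ℝ) (v v' : Vec b) :
    M *ₑ (v - v') = M *ₑ v - M *ₑ v' := map_sub (Matrix.toEuclideanLin M) v v'

theorem matAct_neg {a b : ℕ} (M : Matrix (Fin a) (Fin b) ℝ) (v : Vec b) :
    M *ₑ (-v) = -(M *ₑ v) := map_neg (Matrix.toEuclideanLin M) v

theorem matAct_smul {a b : ℕ} (M : Matrix (Fin a) (Fin b) ℝ) (c : ℝ) (v : Vec b) :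
    M *ₑ (c • v) = c • (M *ₑ v) := map_smul (Matrix.toEuclideanLin M) c v

theorem matAct_zero {a b : ℕ} (M : Matrix (Fin a) (Fin b) ℝ) :
    M *ₑ (0 : Vec b) = 0 := map_zero (Matrix.toEuclideanLin M)

theorem Matrix.ext_matAct {a b : ℕ} {M N : Matrix (Fin a) (Fin b) ℝ}
    (h : ∀ v, M *ₑ v = N *ₑ v) : M = N :=
  (Matrix.toEuclideanLin (𝕜 := ℝ)).injective (LinearMap.ext h)

theorem inner_transpose_matAct {a b : ℕ} (M : Matrix (Fin a) (Fin b) ℝ) (v : Vec a) (x : Vec b) :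
    inner ℝ (Mᵀ *ₑ v) x = inner ℝ v (M *ₑ x) := by
  simp [matAct, Matrix.toLpLin_apply, EuclideanSpace.inner_eq_star_dotProduct,
    Matrix.dotProduct_mulVec, Matrix.mulVec_transpose,
    dotProduct_comm]

/-- The matrix action as a continuous linear map. -/
noncomputable def matCLM {a b : ℕ} (M : Matrix (Fin a) (Fin b) ℝ) : Vec b →L[ℝ] Vec a :=
  LinearMap.toContinuousLinearMap (Matrix.toEuclideanLin M)

@[simp] theorem matCLM_apply {a b : ℕ} (M : Matrix (Fin a) (Fin b) ℝ) (v : Vec b) :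
    matCLM M v = M *ₑ v := rfl

theorem matAct_norm_le {a b : ℕ} (M : Matrix (Fin a) (Fin b) ℝ) (v : Vec b) :
    ‖M *ₑ v‖ ≤ ‖matCLM M‖ * ‖v‖ := (matCLM M).le_opNorm v

theorem Matrix.mulVec_injective_of_rank_eq {ι : Type*} [Fintype ι] {q : ℕ}
    {M : Matrix ι (Fin q) ℝ} (h : M.rank = q) : Function.Injective M.mulVec := by
  have h1 := M.mulVecLin.finrank_range_add_finrank_ker
  rw [Matrix.rank] at h
  rw [h, Module.finrank_fintype_fun_eq_card, Fintype.card_fin] at h1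
  have h2 : Module.finrank ℝ (LinearMap.ker M.mulVecLin) = 0 := by omega
  exact LinearMap.ker_eq_bot.1 (Submodule.finrank_eq_zero.1 h2)

theorem Matrix.rank_eq_of_mulVec_injective {ι : Type*} [Fintype ι] {q : ℕ}
    {M : Matrix ι (Fin q) ℝ} (h : Function.Injective M.mulVec) : M.rank = q := by
  rw [Matrix.rank, LinearMap.finrank_range_of_inj (f := M.mulVecLin) h]
  simp

theorem Matrix.exists_right_inverse_of_rank_eq {k m : ℕ} {N : Matrix (Fin k) (Fin m) ℝ}
    (h : N.rank = k) : ∃ R : Matrix (Fin m) (Fin k) ℝ, N * R = 1 := by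
  have h1 : LinearMap.range N.mulVecLin = ⊤ := by
    refine Submodule.eq_top_of_finrank_eq ?_
    rw [Matrix.rank] at h
    simp [h]
  exact Matrix.mulVec_surjective_iff_exists_right_inverse.1 (LinearMap.range_eq_top.1 h1)

/-! ### The feasible affine subspace -/

section FeasibleSubspace

variable {n m r nw nc q : ℕ} {S : Plant n m r nw} {O : OSSData m r nw nc}
  {Tz : Matrix (Fin r) (Fin q) ℝ} {Tu : Matrix (Fin m) (Fin q) ℝ}

theorem SpansFeasibleSubspace.exists_iff (hT : SpansFeasibleSubspace S O Tz Tu) (z : Vec r)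
    (u : Vec m) :
    (∃ ξ : Vec q, Tz *ₑ ξ = z ∧ Tu *ₑ ξ = u) ↔ z = S.Gu *ₑ u ∧ O.Hz *ₑ z + O.Hu *ₑ u = 0 := by
  have h := SetLike.ext_iff.1 hT (Sum.elim z.ofLp u.ofLp)
  have h1 : Sum.elim z.ofLp u.ofLp ∈ LinearMap.range (Matrix.fromRows Tz Tu).mulVecLin ↔
      ∃ ξ : Vec q, Tz *ₑ ξ = z ∧ Tu *ₑ ξ = u := by
    constructor
    · rintro ⟨x, hx⟩
      rw [Matrix.mulVecLin_apply, Matrix.fromRows_mulVec] at hx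
      refine ⟨WithLp.toLp 2 x, ?_, ?_⟩
      · ext i
        exact congrFun hx (Sum.inl i)
      · ext i
        exact congrFun hx (Sum.inr i)
    · rintro ⟨ξ, rfl, rfl⟩
      refine ⟨ξ.ofLp, ?_⟩
      rw [Matrix.mulVecLin_apply, Matrix.fromRows_mulVec]
      rfl
  have h2 : Sum.elim z.ofLp u.ofLp ∈
      LinearMap.ker (Matrix.fromBlocks 1 (-S.Gu) O.Hz O.Hu).mulVecLin ↔
      z = S.Gu *ₑ u ∧ O.Hz *ₑ z + O.Hu *ₑ u = 0 := by
    rw [LinearMap.mem_ker, Matrix.mulVecLin_apply, Matrix.fromBlocks_mulVec]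
    constructor
    · intro hx
      constructor
      · ext i
        have := congrFun hx (Sum.inl i)
        simp [Matrix.neg_mulVec] at this
        simp [matAct, Matrix.toLpLin_apply]
        linarith
      · ext i
        have := congrFun hx (Sum.inr i)
        simpa [matAct, Matrix.toLpLin_apply] using this
    · rintro ⟨hz, hH⟩
      ext i
      rcases i with i | i
      · have := congrArg (fun v : Vec r => v.ofLp i) hz
        simp [matAct, Matrix.toLpLin_apply] at this
        simp [Matrix.neg_mulVec]
        linarith
      · have := congrArg (fun v : Vec nc => v.ofLp i) hH
        simpa [matAct, Matrix.toLpLin_apply] using this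
  rw [← h1, h, h2]

theorem SpansFeasibleSubspace.Tz_eq (hT : SpansFeasibleSubspace S O Tz Tu) (ξ : Vec q) :
    Tz *ₑ ξ = S.Gu *ₑ (Tu *ₑ ξ) :=
  ((hT.exists_iff _ _).1 ⟨ξ, rfl, rfl⟩).1

theorem constraintGain_matAct (u : Vec m) :
    constraintGain S O *ₑ u = O.Hz *ₑ (S.Gu *ₑ u) + O.Hu *ₑ u := by
  rw [constraintGain, matAct_add_matrix, matAct_mul]

theorem SpansFeasibleSubspace.constraintGain_Tu (hT : SpansFeasibleSubspace S O Tz Tu)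
    (ξ : Vec q) : constraintGain S O *ₑ (Tu *ₑ ξ) = 0 := by
  rw [constraintGain_matAct, ← hT.Tz_eq]
  exact ((hT.exists_iff _ _).1 ⟨ξ, rfl, rfl⟩).2

theorem SpansFeasibleSubspace.exists_of_constraintGain_eq_zero
    (hT : SpansFeasibleSubspace S O Tz Tu) {v : Vec m} (hv : constraintGain S O *ₑ v = 0) :
    ∃ ξ : Vec q, Tu *ₑ ξ = v := by
  rw [constraintGain_matAct] at hv
  obtain ⟨ξ, -, h⟩ := (hT.exists_iff (S.Gu *ₑ v) v).2 ⟨rfl, hv⟩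
  exact ⟨ξ, h⟩

/-- Since `T_z = G_u T_u`, the kernel of `T_u` is already that of `T`. -/
theorem SpansFeasibleSubspace.Tu_injective (hT : SpansFeasibleSubspace S O Tz Tu)
    (hTrank : (Matrix.fromRows Tz Tu).rank = q) {ξ ξ' : Vec q} (h : Tu *ₑ ξ = Tu *ₑ ξ') :
    ξ = ξ' := by
  have hz : Tz *ₑ ξ = Tz *ₑ ξ' := by rw [hT.Tz_eq, hT.Tz_eq, h]
  have := Matrix.mulVec_injective_of_rank_eq hTrank (a₁ := ξ.ofLp) (a₂ := ξ'.ofLp) (by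
    rw [Matrix.fromRows_mulVec, Matrix.fromRows_mulVec]
    congr 1
    · exact congrArg WithLp.ofLp hz
    · exact congrArg WithLp.ofLp h)
  exact WithLp.ofLp_injective _ this

theorem SteadyStateConstraints.add (hT : SpansFeasibleSubspace S O Tz Tu) {w : Vec nw}
    {z : Vec r} {u : Vec m} (h : SteadyStateConstraints S O w z u) (ξ : Vec q) :
    SteadyStateConstraints S O w (z + Tz *ₑ ξ) (u + Tu *ₑ ξ) := by
  obtain ⟨h1, h2⟩ := (hT.exists_iff _ _).1 ⟨ξ, rfl, rfl⟩
  refine ⟨?_, ?_⟩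
  · rw [matAct_add, ← h1]
    linear_combination (norm := module) h.1
  · rw [matAct_add, matAct_add]
    linear_combination (norm := module) h.2 - h2

theorem SteadyStateConstraints.exists_eq_add (hT : SpansFeasibleSubspace S O Tz Tu) {w : Vec nw}
    {z z' : Vec r} {u u' : Vec m} (h : SteadyStateConstraints S O w z u)
    (h' : SteadyStateConstraints S O w z' u') :
    ∃ ξ : Vec q, z' = z + Tz *ₑ ξ ∧ u' = u + Tu *ₑ ξ := by
  obtain ⟨ξ, h1, h2⟩ := (hT.exists_iff (z' - z) (u' - u)).2 ⟨by
    rw [matAct_sub]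
    linear_combination (norm := module) h'.1 - h.1, by
    rw [matAct_sub, matAct_sub]
    linear_combination (norm := module) h.2 - h'.2⟩
  exact ⟨ξ, by rw [h1]; abel, by rw [h2]; abel⟩

/-- A right inverse of `N` lets the input absorb a change of disturbance. Feasible points can thus
be transported linearly in `w`, which reduces continuity of optimizers to a problem with translated
affine subspaces. -/
theorem exists_linear_particular_solution (hN : (constraintGain S O).rank = nc) :
    ∃ (Lz : Vec nw →L[ℝ] Vec r) (Lu : Vec nw →L[ℝ] Vec m), ∀ w w' z u,
      SteadyStateConstraints S O w z u →
        SteadyStateConstraints S O w' (z + Lz (w' - w)) (u + Lu (w' - w)) := by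
  obtain ⟨R, hR⟩ := Matrix.exists_right_inverse_of_rank_eq hN
  let Lu : Vec nw →L[ℝ] Vec m := matCLM (-(R * (O.Hz * S.Gw + O.Hw)))
  have hLu : ∀ v, Lu v = -(R *ₑ (O.Hz *ₑ (S.Gw *ₑ v) + O.Hw *ₑ v)) := fun v => by
    simp only [Lu, matCLM_apply, matAct_neg_matrix, matAct_mul, matAct_add_matrix]
  refine ⟨matCLM S.Gu ∘L Lu + matCLM S.Gw, Lu, fun w w' z u h => ?_⟩
  have hNR : ∀ v, O.Hz *ₑ (S.Gu *ₑ (R *ₑ v)) + O.Hu *ₑ (R *ₑ v) = v := fun v => by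
    rw [← constraintGain_matAct, ← matAct_mul, hR, matAct_one]
  have key := hNR (O.Hz *ₑ (S.Gw *ₑ (w' - w)) + O.Hw *ₑ (w' - w))
  have h1 := h.1
  have h2 := h.2
  simp only [SteadyStateConstraints, _root_.add_apply, ContinuousLinearMap.comp_apply,
    matCLM_apply]
  set d := w' - w with hd
  have hw' : w' = w + d := by rw [hd]; abel
  rw [hw', hLu]
  constructor
  · simp only [matAct_add, matAct_neg] at *
    linear_combination (norm := module) h1
  · simp only [matAct_add, matAct_neg] at *
    linear_combination (norm := module) h2 + key

end FeasibleSubspace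

/-! ### Strong convexity and continuous dependence of optimizers -/

open Filter Topology in
/-- First-order characterization of strong convexity. -/
theorem StrongConvexOn.add_fderiv_add_sq_le {E : Type*} [NormedAddCommGroup E]
    [NormedSpace ℝ E] {s : Set E} {κ : ℝ} {f : E → ℝ} (hf : StrongConvexOn s κ f)
    {x y : E} (hx : x ∈ s) (hy : y ∈ s) {f' : E →L[ℝ] ℝ} (hf' : HasFDerivAt f f' x) :
    f x + f' (y - x) + κ / 2 * ‖y - x‖ ^ 2 ≤ f y := by
  have hline : HasDerivAt (fun t : ℝ => x + t • (y - x)) (y - x) 0 := by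
    simpa using ((hasDerivAt_id (0 : ℝ)).smul_const (y - x)).const_add x
  have hf0 : HasFDerivAt f f' (x + (0 : ℝ) • (y - x)) := by simpa using hf'
  have hd : HasDerivAt (fun t : ℝ => f (x + t • (y - x))) (f' (y - x)) 0 :=
    hf0.comp_hasDerivAt (0 : ℝ) hline
  have hslope := (hasDerivAt_iff_tendsto_slope.1 hd).mono_left
    (nhdsWithin_mono (0 : ℝ) (s := Set.Ioi 0) (fun t (ht : 0 < t) => ht.ne'))
  -- The strong convexity inequality on the segment, divided by `t`, bounds the slope by this
  -- expression; then `t → 0⁺`.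
  have hrhs : Tendsto (fun t : ℝ => f y - f x - (1 - t) * (κ / 2 * ‖y - x‖ ^ 2)) (𝓝[>] 0)
      (𝓝 (f y - f x - (1 - 0) * (κ / 2 * ‖y - x‖ ^ 2))) := by
    refine Tendsto.mono_left (Continuous.tendsto ?_ 0) nhdsWithin_le_nhds
    fun_prop
  have hle := le_of_tendsto_of_tendsto hslope hrhs (by
    filter_upwards [self_mem_nhdsWithin, mem_nhdsWithin_of_mem_nhds (Iio_mem_nhds one_pos)]
      with t (ht : 0 < t) (ht1 : t < 1)
    have h1 := hf.2 hx hy (sub_nonneg.2 ht1.le) ht.le (sub_add_cancel 1 t)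
    have h2 : (1 - t) • x + t • y = x + t • (y - x) := by module
    rw [h2, norm_sub_rev] at h1
    simp only [smul_eq_mul] at h1
    rw [slope_def_field, sub_zero, zero_smul, add_zero, div_le_iff₀ ht]
    nlinarith)
  linarith

open Filter Topology Metric in
/-- Minimizers of a convex function along an affine subspace stay close to a strict interior
minimizer when the subspace is translated slightly. -/
theorem eventually_minimizer_mem_nhds {E X Y W : Type*} [NormedAddCommGroup E] [NormedSpace ℝ E]
    [FiniteDimensional ℝ E] [NormedAddCommGroup X] [NormedSpace ℝ X] [NormedAddCommGroup Y]
    [NormedSpace ℝ Y] [NormedAddCommGroup W] [NormedSpace ℝ W] {U : Set X} {Z : Set Y}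
    {f : X → ℝ} {g : Y → ℝ} (hf : ConvexOn ℝ U f) (hg : ConvexOn ℝ Z g)
    (hfc : ContinuousOn f (interior U)) (hgc : ContinuousOn g (interior Z))
    {u₀ : X} (hu₀ : u₀ ∈ interior U) {z₀ : Y} (hz₀ : z₀ ∈ interior Z)
    (Tu : E →L[ℝ] X) (Tz : E →L[ℝ] Y) (Lu : W →L[ℝ] X) (Lz : W →L[ℝ] Y)
    (hlt : ∀ ξ, ξ ≠ 0 → u₀ + Tu ξ ∈ U → z₀ + Tz ξ ∈ Z →
      f u₀ + g z₀ < f (u₀ + Tu ξ) + g (z₀ + Tz ξ))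
    {Nu : Set X} (hNu : Nu ∈ 𝓝 u₀) {Nz : Set Y} (hNz : Nz ∈ 𝓝 z₀) :
    ∀ᶠ d in 𝓝 (0 : W), u₀ + Lu d ∈ U ∧ z₀ + Lz d ∈ Z ∧ ∀ ξ, u₀ + Lu d + Tu ξ ∈ U →
      z₀ + Lz d + Tz ξ ∈ Z →
      f (u₀ + Lu d + Tu ξ) + g (z₀ + Lz d + Tz ξ) ≤ f (u₀ + Lu d) + g (z₀ + Lz d) →
      u₀ + Lu d + Tu ξ ∈ Nu ∧ z₀ + Lz d + Tz ξ ∈ Nz := by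
  have hau : Continuous fun x : W × E => u₀ + Lu x.1 + Tu x.2 := by fun_prop
  have haz : Continuous fun x : W × E => z₀ + Lz x.1 + Tz x.2 := by fun_prop
  have hGz : z₀ ∈ interior (Nz ∩ Z) := by
    rw [interior_inter]
    exact ⟨mem_interior_iff_mem_nhds.2 hNz, hz₀⟩
  have hGu : u₀ ∈ interior (Nu ∩ U) := by
    rw [interior_inter]
    exact ⟨mem_interior_iff_mem_nhds.2 hNu, hu₀⟩
  have hev : ∀ᶠ x : W × E in 𝓝 ((0 : W), (0 : E)),
      z₀ + Lz x.1 + Tz x.2 ∈ interior (Nz ∩ Z) ∧ u₀ + Lu x.1 + Tu x.2 ∈ interior (Nu ∩ U) :=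
    (haz.continuousAt.eventually (isOpen_interior.mem_nhds (by simpa using hGz))).and
      (hau.continuousAt.eventually (isOpen_interior.mem_nhds (by simpa using hGu)))
  rw [nhds_prod_eq, Filter.eventually_prod_iff] at hev
  obtain ⟨pw, hpw, pξ, hpξ, hin⟩ := hev
  obtain ⟨δ, hδ, hball⟩ := Metric.nhds_basis_closedBall.mem_iff.1 hpξ
  have hball0 : pξ 0 := hball (mem_closedBall_self hδ.le)
  have hcont : ∀ ξ, pξ ξ → ContinuousAt (fun x : W × E =>
      f (u₀ + Lu x.1 + Tu x.2) + g (z₀ + Lz x.1 + Tz x.2)) (0, ξ) := by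
    intro ξ hξ
    obtain ⟨hz, hu⟩ := hin hpw.self_of_nhds hξ
    rw [interior_inter] at hz hu
    have hf' := hfc.continuousAt (isOpen_interior.mem_nhds hu.2)
    have hg' := hgc.continuousAt (isOpen_interior.mem_nhds hz.2)
    exact (ContinuousAt.comp (x := ((0 : W), ξ)) hf' hau.continuousAt).add
      (ContinuousAt.comp (x := ((0 : W), ξ)) hg' haz.continuousAt)
  have hsphere : ∀ ξ ∈ sphere (0 : E) δ, ∀ᶠ x : W × E in 𝓝 0 ×ˢ 𝓝 ξ,
      f (u₀ + Lu x.1) + g (z₀ + Lz x.1) <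
        f (u₀ + Lu x.1 + Tu x.2) + g (z₀ + Lz x.1 + Tz x.2) := by
    intro ξ hξ
    have hpξ' : pξ ξ := hball (sphere_subset_closedBall hξ)
    obtain ⟨hz, hu⟩ := hin hpw.self_of_nhds hpξ'
    have hξ0 : ξ ≠ 0 := ne_of_mem_sphere hξ hδ.ne'
    have hlt' := hlt ξ hξ0 (by simpa using (interior_subset hu).2)
      (by simpa using (interior_subset hz).2)
    have hc1 : Tendsto (fun x : W × E =>
        f (u₀ + Lu x.1 + Tu x.2) + g (z₀ + Lz x.1 + Tz x.2)) (𝓝 0 ×ˢ 𝓝 ξ)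
        (𝓝 (f (u₀ + Tu ξ) + g (z₀ + Tz ξ))) := by
      have h1 := (hcont ξ hpξ').tendsto
      rw [nhds_prod_eq] at h1
      simpa using h1
    have hc0 : Tendsto (fun x : W × E => f (u₀ + Lu x.1) + g (z₀ + Lz x.1)) (𝓝 0 ×ˢ 𝓝 ξ)
        (𝓝 (f u₀ + g z₀)) := by
      have h2 : Continuous fun x : W × E => ((x.1, 0) : W × E) := by fun_prop
      have h1 := (hcont 0 hball0).tendsto.comp (h2.tendsto ((0 : W), ξ))
      rw [nhds_prod_eq] at h1
      simpa [Function.comp_def] using h1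
    exact hc0.eventually_lt hc1 hlt'
  -- Compactness of the sphere makes the strict inequality uniform in `ξ` for all small translations
  -- `d`.
  have hcompact : ∀ᶠ d in 𝓝 (0 : W), ∀ ξ ∈ sphere (0 : E) δ,
      f (u₀ + Lu d) + g (z₀ + Lz d) < f (u₀ + Lu d + Tu ξ) + g (z₀ + Lz d + Tz ξ) :=
    (isCompact_sphere (0 : E) δ).eventually_forall_of_forall_eventually
      fun ξ hξ => by simpa only [nhds_prod_eq] using hsphere ξ hξ
  filter_upwards [hpw, hcompact] with d hd hdS
  obtain ⟨h0z, h0u⟩ := hin hd hball0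
  have h0u' := (interior_subset h0u).2
  have h0z' := (interior_subset h0z).2
  rw [map_zero, add_zero] at h0u' h0z'
  refine ⟨h0u', h0z', fun ξ hu hz hle => ?_⟩
  -- Were `ξ` outside the ball, convexity on the segment from the centre would give a value on the
  -- sphere not exceeding the central one.
  have hξδ : ‖ξ‖ ≤ δ := by
    by_contra! hlt
    have hpos : 0 < ‖ξ‖ := hδ.trans hlt
    set t := δ / ‖ξ‖ with ht
    have ht0 : 0 < t := div_pos hδ hpos
    have ht1 : t < 1 := (div_lt_one hpos).2 hlt
    have hts : t • ξ ∈ sphere (0 : E) δ := by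
      rw [mem_sphere_zero_iff_norm, norm_smul, Real.norm_of_nonneg ht0.le, ht,
        div_mul_cancel₀ _ hpos.ne']
    have hgt := hdS _ hts
    have h1 := hf.2 h0u' hu (sub_nonneg.2 ht1.le) ht0.le (sub_add_cancel 1 t)
    have h2 := hg.2 h0z' hz (sub_nonneg.2 ht1.le) ht0.le (sub_add_cancel 1 t)
    have e1 : (1 - t) • (u₀ + Lu d) + t • (u₀ + Lu d + Tu ξ) = u₀ + Lu d + Tu (t • ξ) := by
      rw [map_smul]
      module
    have e2 : (1 - t) • (z₀ + Lz d) + t • (z₀ + Lz d + Tz ξ) = z₀ + Lz d + Tz (t • ξ) := by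
      rw [map_smul]
      module
    rw [e1] at h1
    rw [e2] at h2
    simp only [smul_eq_mul] at h1 h2
    have h4 := mul_le_mul_of_nonneg_left hle ht0.le
    linarith
  obtain ⟨hz', hu'⟩ := hin hd (hball (mem_closedBall_zero_iff.2 hξδ))
  exact ⟨(interior_subset hu').1, (interior_subset hz').1⟩

theorem SteadyStateConstraints.strongConvexOn {n m r nw nc q : ℕ} {S : Plant n m r nw}
    {O : OSSData m r nw nc} {Tz : Matrix (Fin r) (Fin q) ℝ} {Tu : Matrix (Fin m) (Fin q) ℝ}
    (hT : SpansFeasibleSubspace S O Tz Tu) {w : Vec nw} {z z' : Vec r} {u u' : Vec m}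
    (h : SteadyStateConstraints S O w z u) (h' : SteadyStateConstraints S O w z' u') {κ : ℝ}
    (hconv : StrongConvexOn {ξ : Vec q | Tu *ₑ ξ + u ∈ O.U ∧ Tz *ₑ ξ + z ∈ O.Z} κ
        (fun ξ => O.f₀ (Tu *ₑ ξ + u) + O.g₀ (Tz *ₑ ξ + z))) :
    StrongConvexOn {ξ : Vec q | u' + Tu *ₑ ξ ∈ O.U ∧ z' + Tz *ₑ ξ ∈ O.Z} κ
        (fun ξ => O.f₀ (u' + Tu *ₑ ξ) + O.g₀ (z' + Tz *ₑ ξ)) := by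
  obtain ⟨ξ₀, rfl, rfl⟩ := h.exists_eq_add hT h'
  have hu : ∀ ξ, u + Tu *ₑ ξ₀ + Tu *ₑ ξ = Tu *ₑ (ξ₀ + ξ) + u := fun ξ => by
    rw [matAct_add]; abel
  have hz : ∀ ξ, z + Tz *ₑ ξ₀ + Tz *ₑ ξ = Tz *ₑ (ξ₀ + ξ) + z := fun ξ => by
    rw [matAct_add]; abel
  simp only [hu, hz]
  refine ⟨hconv.1.translate_preimage_right ξ₀, fun x hx y hy a b ha hb hab => ?_⟩
  have h1 := hconv.2 hx hy ha hb hab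
  have h2 : a • (ξ₀ + x) + b • (ξ₀ + y) = ξ₀ + (a • x + b • y) := by
    rw [smul_add, smul_add, add_add_add_comm, ← add_smul, hab, one_smul]
  rw [h2, add_sub_add_left_eq_sub] at h1
  exact h1

section

variable {n m r nw nc q : ℕ} {S : Plant n m r nw} {O : OSSData m r nw nc}
  {Tz : Matrix (Fin r) (Fin q) ℝ} {Tu : Matrix (Fin m) (Fin q) ℝ}

/-- The reduced objective grows strictly away from an optimal point. -/
theorem IsOptimal.lt_of_strongConvexOn (hT : SpansFeasibleSubspace S O Tz Tu) {w : Vec nw}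
    {z : Vec r} {u : Vec m} (hopt : IsOptimal S O w z u) {κ : ℝ} (hκ : 0 < κ)
    (hconv : StrongConvexOn {ξ : Vec q | u + Tu *ₑ ξ ∈ O.U ∧ z + Tz *ₑ ξ ∈ O.Z} κ
        (fun ξ => O.f₀ (u + Tu *ₑ ξ) + O.g₀ (z + Tz *ₑ ξ))) {ξ : Vec q} (hξ : ξ ≠ 0)
    (hu : u + Tu *ₑ ξ ∈ O.U) (hz : z + Tz *ₑ ξ ∈ O.Z) :
    O.f₀ u + O.g₀ z < O.f₀ (u + Tu *ₑ ξ) + O.g₀ (z + Tz *ₑ ξ) := by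
  by_contra! hle
  have h0 : (0 : Vec q) ∈ {ξ : Vec q | u + Tu *ₑ ξ ∈ O.U ∧ z + Tz *ₑ ξ ∈ O.Z} := by
    simp only [Set.mem_ofPred_eq, matAct_zero, add_zero]
    exact ⟨hopt.1.2.1, hopt.1.1⟩
  -- If the value at `ξ` were no larger, the midpoint of `0` and `ξ` would be feasible and strictly
  -- better than the optimum.
  have h1 := hconv.2 h0 (show ξ ∈ _ from ⟨hu, hz⟩) (by norm_num : (0 : ℝ) ≤ 1 / 2)
    (by norm_num : (0 : ℝ) ≤ 1 / 2) (by norm_num)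
  have h2 := hconv.1 h0 (show ξ ∈ _ from ⟨hu, hz⟩) (by norm_num : (0 : ℝ) ≤ 1 / 2)
    (by norm_num : (0 : ℝ) ≤ 1 / 2) (by norm_num)
  have h3 := hopt.2 _ _ ⟨h2.2, h2.1, hopt.1.2.2.add hT _⟩
  simp only [smul_eq_mul, matAct_zero, add_zero, zero_sub, norm_neg] at h1
  have h4 : 0 < ‖ξ‖ := norm_pos_iff.2 hξ
  nlinarith [mul_pos hκ (pow_pos h4 2)]

open Filter Topology Metric in
/-- Optimal points in the interiors depend continuously on the disturbance. -/
theorem IsOptimal.eventually_exists_close (hT : SpansFeasibleSubspace S O Tz Tu)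
    (hO : StandingAssumptions S O) (hN : (constraintGain S O).rank = nc) {w₀ : Vec nw}
    {z₀ : Vec r} {u₀ : Vec m} (hopt : IsOptimal S O w₀ z₀ u₀) (hz₀ : z₀ ∈ interior O.Z)
    (hu₀ : u₀ ∈ interior O.U) {κ : ℝ} (hκ : 0 < κ)
    (hconv : StrongConvexOn {ξ : Vec q | u₀ + Tu *ₑ ξ ∈ O.U ∧ z₀ + Tz *ₑ ξ ∈ O.Z} κ
        (fun ξ => O.f₀ (u₀ + Tu *ₑ ξ) + O.g₀ (z₀ + Tz *ₑ ξ)))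
    {Nz : Set (Vec r)} (hNz : Nz ∈ 𝓝 z₀) {Nu : Set (Vec m)} (hNu : Nu ∈ 𝓝 u₀) :
    ∀ᶠ w in 𝓝 w₀, ∀ z u, IsOptimal S O w z u → z ∈ Nz ∧ u ∈ Nu := by
  obtain ⟨Lz, Lu, hL⟩ := exists_linear_particular_solution (S := S) (O := O) hN
  have hev := eventually_minimizer_mem_nhds hO.convexOn_f₀ hO.convexOn_g₀
    hO.contDiffOn_f₀.continuousOn hO.contDiffOn_g₀.continuousOn hu₀ hz₀ (matCLM Tu) (matCLM Tz)
    Lu Lz (fun ξ hξ hu hz => hopt.lt_of_strongConvexOn hT hκ hconv hξ hu hz) hNu hNz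
  have htend : Tendsto (fun w => w - w₀) (𝓝 w₀) (𝓝 0) := by
    have : Continuous fun w : Vec nw => w - w₀ := by fun_prop
    simpa using this.tendsto w₀
  filter_upwards [htend.eventually hev] with w hw z u hzu
  obtain ⟨hu, hz, hmin⟩ := hw
  have hfeas := hL w₀ w _ _ hopt.1.2.2
  obtain ⟨ξ, rfl, rfl⟩ := hfeas.exists_eq_add hT hzu.1.2.2
  exact (hmin ξ hzu.1.2.1 hzu.1.1 (hzu.2 _ _ ⟨hz, hu, hfeas⟩)).symm

open Metric NNReal in
/-- `(z, u)` is an optimal point in the interiors of the domains, near which the gradients are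
Lipschitz with constant `L`. -/
def IsRegularOptimal (S : Plant n m r nw) (O : OSSData m r nw nc) (L : ℝ≥0) (w : Vec nw)
    (z : Vec r) (u : Vec m) : Prop :=
  IsOptimal S O w z u ∧ ∃ R > 0, ball z R ⊆ interior O.Z ∧ ball u R ⊆ interior O.U ∧
    LipschitzOnWith L (gradient O.g₀) (ball z R) ∧ LipschitzOnWith L (gradient O.f₀) (ball u R)

-- Near each `w₁` the optimizers stay in neighbourhoods on which the gradients have fixed Lipschitz
-- constants; finitely many such `w₁` cover `W`. Only `L` has to be uniform: the radius in
-- `IsRegularOptimal` may depend on `w`.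
open Filter Topology Metric NNReal in
theorem StandingAssumptions.exists_uniform_lipschitz (hT : SpansFeasibleSubspace S O Tz Tu)
    (hO : StandingAssumptions S O) (hN : (constraintGain S O).rank = nc)
    (z₀ : Vec nw → Vec r) (u₀ : Vec nw → Vec m)
    (h₀ : ∀ w ∈ O.W, SteadyStateConstraints S O w (z₀ w) (u₀ w))
    (hconv : ∀ w ∈ O.W, ∃ κ : ℝ, 0 < κ ∧
      StrongConvexOn {ξ : Vec q | Tu *ₑ ξ + u₀ w ∈ O.U ∧ Tz *ₑ ξ + z₀ w ∈ O.Z} κ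
        (fun ξ => O.f₀ (Tu *ₑ ξ + u₀ w) + O.g₀ (Tz *ₑ ξ + z₀ w))) :
    ∃ L : ℝ≥0, ∀ w ∈ O.W, ∃ z u, IsRegularOptimal S O L w z u := by
  refine hO.isCompact_W.induction_on (p := fun s => ∃ L : ℝ≥0, ∀ w ∈ s ∩ O.W, ∃ z u,
    IsRegularOptimal S O L w z u) ⟨0, by simp⟩ ?_ ?_ ?_ |>.imp
      fun L h w hw => h w ⟨hw, hw⟩
  · rintro s t hst ⟨L, h⟩
    exact ⟨L, fun w hw => h w ⟨hst hw.1, hw.2⟩⟩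
  · have hmono : ∀ {L L' : ℝ≥0} {w : Vec nw}, L ≤ L' →
        (∃ z u, IsRegularOptimal S O L w z u) → ∃ z u, IsRegularOptimal S O L' w z u := by
      rintro L L' w hL ⟨z, u, h, R, hR, hz, hu, hg, hf⟩
      exact ⟨z, u, h, R, hR, hz, hu, hg.weaken hL, hf.weaken hL⟩
    rintro s t ⟨L, h⟩ ⟨L', h'⟩
    refine ⟨max L L', fun w hw => ?_⟩
    rcases hw.1 with hs | ht
    · exact hmono (le_max_left _ _) (h w ⟨hs, hw.2⟩)
    · exact hmono (le_max_right _ _) (h' w ⟨ht, hw.2⟩)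
  · intro w₁ hw₁
    obtain ⟨z₁, hz₁, u₁, hu₁, hopt⟩ := hO.exists_optimal w₁ hw₁
    obtain ⟨κ, hκ, hc⟩ := hconv w₁ hw₁
    have hc' := (h₀ w₁ hw₁).strongConvexOn hT hopt.1.2.2 hc
    obtain ⟨Lg, tg, htg, hLg⟩ := hO.locallyLipschitz_grad_g₀ hz₁
    obtain ⟨Lf, tf, htf, hLf⟩ := hO.locallyLipschitz_grad_f₀ hu₁
    rw [isOpen_interior.nhdsWithin_eq hz₁] at htg
    rw [isOpen_interior.nhdsWithin_eq hu₁] at htf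
    -- Open neighbourhoods are needed so that a ball around each nearby optimizer fits inside.
    have hz : interior (tg ∩ interior O.Z) ∈ 𝓝 z₁ :=
      interior_mem_nhds.2 (inter_mem htg (isOpen_interior.mem_nhds hz₁))
    have hu : interior (tf ∩ interior O.U) ∈ 𝓝 u₁ :=
      interior_mem_nhds.2 (inter_mem htf (isOpen_interior.mem_nhds hu₁))
    have hev := hopt.eventually_exists_close hT hO hN hz₁ hu₁ hκ hc' hz hu
    refine ⟨_, mem_nhdsWithin_of_mem_nhds hev, max Lf Lg, fun w hw => ?_⟩
    obtain ⟨z, -, u, -, hzu⟩ := hO.exists_optimal w hw.2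
    obtain ⟨hzm, hum⟩ := hw.1 z u hzu
    obtain ⟨R, hR, hRz⟩ := Metric.isOpen_iff.1 isOpen_interior z hzm
    obtain ⟨R', hR', hRu⟩ := Metric.isOpen_iff.1 isOpen_interior u hum
    have hz' : ball z (min R R') ⊆ tg ∩ interior O.Z :=
      (ball_subset_ball (min_le_left _ _)).trans (hRz.trans interior_subset)
    have hu' : ball u (min R R') ⊆ tf ∩ interior O.U :=
      (ball_subset_ball (min_le_right _ _)).trans (hRu.trans interior_subset)
    exact ⟨z, u, hzu, min R R', lt_min hR hR', fun x hx => (hz' hx).2, fun x hx => (hu' hx).2,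
      (hLg.mono fun x hx => (hz' hx).1).weaken (le_max_right _ _),
      (hLf.mono fun x hx => (hu' hx).1).weaken (le_max_left _ _)⟩

end

/-! ### Dissipation across three time scales -/

/-- Here `eᵢ = 1 / τᵢ`, and `G`, `a`, `b` are the norms of the slow gradient and the two deviations.
Every cross term is split between the squares `e₁ G²`, `e₂ a²`, `b²`: terms `e₁ G a` need `e₁ ≪ e₂`,
terms `e₂ a b` need `e₂ ≪ 1`. -/
theorem three_timescale_dissipation_ineq {p C : ℝ} (hp : 0 < p) (hC : 0 ≤ C) :
    ∃ τstar > (0 : ℝ), ∃ ρ > (0 : ℝ), ∀ e₁ e₂ : ℝ, 0 < e₁ → 0 < e₂ → e₂ * τstar < 1 →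
      ρ * e₁ < e₂ → ∀ G a b : ℝ, 0 ≤ G → 0 ≤ a → 0 ≤ b →
      -(p * e₁ * G ^ 2) - e₂ * a ^ 2 - b ^ 2 + C * e₁ * G * (a + b) + C * e₂ * a * b +
        C * e₁ * a * (G + a + b) + C * b * (e₁ * (G + a + b) + e₂ * (a + b)) ≤
      -(p * e₁ * G ^ 2 + e₂ * a ^ 2 + b ^ 2) / 4 := by
  -- The summands 1 give `e₂ ≤ 1` and `e₁ ≤ e₂`; the others make each remainder below at most an
  -- eighth of `e₂ a²` or `b²`.
  refine ⟨1 + 256 * C ^ 2 + 16 * C, by positivity, 1 + 32 * C ^ 2 / p + 8 * C, by positivity,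
    fun e₁ e₂ he₁ he₂ hτ hρ G a b hG ha hb => ?_⟩
  have hq : 0 ≤ C ^ 2 / p := by positivity
  have hqp : C ^ 2 / p * p = C ^ 2 := by field_simp
  set k := C ^ 2 / p with hk
  rw [show 32 * C ^ 2 / p = 32 * k by rw [hk]; ring] at hρ
  have hke : 0 ≤ k * e₁ := by positivity
  have hCe : 0 ≤ C * e₁ := by positivity
  have hCe2 : 0 ≤ C * e₂ := by positivity
  have hC2e2 : 0 ≤ C ^ 2 * e₂ := by positivity
  have h1 : e₁ ≤ e₂ := by nlinarith
  have h2 : 32 * (k * e₁) ≤ e₂ := by nlinarith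
  have h3 : 8 * (C * e₁) ≤ e₂ := by nlinarith
  have h4 : 256 * (C ^ 2 * e₂) ≤ 1 := by nlinarith
  have h5 : 16 * (C * e₂) ≤ 1 := by nlinarith
  have h6 : e₂ ≤ 1 := by nlinarith
  have hCle : C * e₁ ≤ C * e₂ := mul_le_mul_of_nonneg_left h1 hC
  -- Young's inequality for each cross term
  have y0 : ∀ x : ℝ, 2 * C * e₁ * G * x ≤ p * e₁ * G ^ 2 / 4 + 4 * (k * e₁) * x ^ 2 := by
    intro x
    have hsq : 0 ≤ e₁ / p * (p * G / 2 - 2 * C * x) ^ 2 := by positivity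
    have : e₁ / p * (p * G / 2 - 2 * C * x) ^ 2 =
        p * e₁ * G ^ 2 / 4 + 4 * (k * e₁) * x ^ 2 - 2 * C * e₁ * G * x := by
      rw [hk]
      field_simp
      ring
    linarith
  have y1 := y0 a
  have y2 := y0 b
  have y3 : 4 * (C * e₂) * (a * b) ≤ e₂ * a ^ 2 / 8 + 32 * (C ^ 2 * e₂) * b ^ 2 := by
    have hsq : 0 ≤ e₂ / 8 * (a - 16 * C * b) ^ 2 := by positivity
    nlinarith
  have z1 : 4 * (k * e₁) * a ^ 2 ≤ e₂ / 8 * a ^ 2 :=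
    mul_le_mul_of_nonneg_right (by linarith) (sq_nonneg a)
  have z2 : 4 * (k * e₁) * b ^ 2 ≤ 1 / 8 * b ^ 2 :=
    mul_le_mul_of_nonneg_right (by linarith) (sq_nonneg b)
  have z3 : 32 * (C ^ 2 * e₂) * b ^ 2 ≤ 1 / 8 * b ^ 2 :=
    mul_le_mul_of_nonneg_right (by linarith) (sq_nonneg b)
  have z4 : C * e₁ * a ^ 2 ≤ e₂ / 8 * a ^ 2 :=
    mul_le_mul_of_nonneg_right (by linarith) (sq_nonneg a)
  have z5 : (C * e₁ + C * e₂) * b ^ 2 ≤ 1 / 8 * b ^ 2 :=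
    mul_le_mul_of_nonneg_right (by linarith) (sq_nonneg b)
  have z6 : 2 * (C * e₁) * (a * b) ≤ 2 * (C * e₂) * (a * b) :=
    mul_le_mul_of_nonneg_right (by linarith) (mul_nonneg ha hb)
  have w1 : 0 ≤ p * e₁ * G ^ 2 := by positivity
  have w2 : 0 ≤ e₂ * a ^ 2 := by positivity
  have w3 : 0 ≤ b ^ 2 := sq_nonneg b
  nlinarith

theorem abs_two_mul_inner_apply_le {Y Y' : Type*} [NormedAddCommGroup Y] [InnerProductSpace ℝ Y]
    [NormedAddCommGroup Y'] [InnerProductSpace ℝ Y'] (Q : Y →L[ℝ] Y) (T : Y' →L[ℝ] Y) (v : Y)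
    (v' : Y') : |2 * inner ℝ (Q v) (T v')| ≤ 2 * ‖Q‖ * ‖T‖ * (‖v‖ * ‖v'‖) := by
  rw [abs_mul, abs_two]
  calc 2 * |inner ℝ (Q v) (T v')| ≤ 2 * (‖Q v‖ * ‖T v'‖) := by
        gcongr
        exact abs_real_inner_le_norm _ _
    _ ≤ 2 * ((‖Q‖ * ‖v‖) * (‖T‖ * ‖v'‖)) := by
        gcongr
        · exact Q.le_opNorm v
        · exact T.le_opNorm v'
    _ = 2 * ‖Q‖ * ‖T‖ * (‖v‖ * ‖v'‖) := by ring

section ThreeTimescale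

variable {X E H : Type*} [NormedAddCommGroup X] [InnerProductSpace ℝ X]
  [NormedAddCommGroup E] [InnerProductSpace ℝ E]
  [NormedAddCommGroup H] [InnerProductSpace ℝ H]

/-- The decrease of the composite Lyapunov function along a three-time-scale system: the slow
variable follows a perturbed gradient flow with gradient `g` and perturbation `r`, the deviations
of the intermediate and of the fast variable from their quasi-steady states are `a` and `b`. -/
theorem three_timescale_dissipation {P : E →L[ℝ] E} {p : ℝ} (hp : 0 < p)
    (hP : ∀ v, p * ‖v‖ ^ 2 ≤ inner ℝ v (P v)) (M : E →L[ℝ] H) (T₁ : E →L[ℝ] X) (T₂ : H →L[ℝ] X)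
    (N : H →L[ℝ] H) (J : X →L[ℝ] H) (A : X →L[ℝ] X) (Q₂ : H →L[ℝ] H) (Q₃ : X →L[ℝ] X)
    (hQ₂ : ∀ v, ‖v‖ ^ 2 ≤ 2 * inner ℝ (Q₂ v) (N v))
    (hQ₃ : ∀ v, 2 * inner ℝ (Q₃ v) (A v) ≤ -‖v‖ ^ 2) {c : ℝ} (hc : 0 ≤ c) :
    ∃ τstar > (0 : ℝ), ∃ ρ > (0 : ℝ), ∀ e₁ e₂ : ℝ, 0 < e₁ → 0 < e₂ → e₂ * τstar < 1 →
      ρ * e₁ < e₂ → ∀ (g r : E) (a : H) (b : X), ‖r‖ ≤ c * (‖a‖ + ‖b‖) →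
      ∀ (F₁ : E) (F₂ : H), F₁ = -(e₁ • (g + r)) → F₂ = -(e₂ • (N a + J b)) →
      inner ℝ g (P F₁) + 2 * inner ℝ (Q₂ a) (F₂ + M F₁) +
        2 * inner ℝ (Q₃ b) (A b + T₁ F₁ + T₂ F₂) ≤
      -(p * e₁ * ‖g‖ ^ 2 + e₂ * ‖a‖ ^ 2 + ‖b‖ ^ 2) / 4 := by
  -- One constant dominates all coupling norms. It involves `c` but no convexity modulus, since `g`
  -- is an arbitrary vector here.
  obtain ⟨C, hC, k1, k2, k3, k4, k5, k6⟩ : ∃ C : ℝ, 0 ≤ C ∧ ‖P‖ * c ≤ C ∧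
      2 * ‖Q₂‖ * ‖J‖ ≤ C ∧ 2 * ‖Q₂‖ * ‖M‖ * (1 + c) ≤ C ∧ 2 * ‖Q₃‖ * ‖T₁‖ * (1 + c) ≤ C ∧
      2 * ‖Q₃‖ * ‖T₂‖ * ‖N‖ ≤ C ∧ 2 * ‖Q₃‖ * ‖T₂‖ * ‖J‖ ≤ C := by
    have h1 : 0 ≤ ‖P‖ * c := by positivity
    have h2 : 0 ≤ 2 * ‖Q₂‖ * ‖J‖ := by positivity
    have h3 : 0 ≤ 2 * ‖Q₂‖ * ‖M‖ * (1 + c) := by positivity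
    have h4 : 0 ≤ 2 * ‖Q₃‖ * ‖T₁‖ * (1 + c) := by positivity
    have h5 : 0 ≤ 2 * ‖Q₃‖ * ‖T₂‖ * ‖N‖ := by positivity
    have h6 : 0 ≤ 2 * ‖Q₃‖ * ‖T₂‖ * ‖J‖ := by positivity
    refine ⟨‖P‖ * c + 2 * ‖Q₂‖ * ‖J‖ + 2 * ‖Q₂‖ * ‖M‖ * (1 + c) + 2 * ‖Q₃‖ * ‖T₁‖ * (1 + c) +
      2 * ‖Q₃‖ * ‖T₂‖ * ‖N‖ + 2 * ‖Q₃‖ * ‖T₂‖ * ‖J‖, by positivity, ?_, ?_, ?_, ?_, ?_, ?_⟩ <;>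
    linarith
  obtain ⟨τ, hτ, ρ, hρ, hineq⟩ := three_timescale_dissipation_ineq hp hC
  refine ⟨τ, hτ, ρ, hρ, fun e₁ e₂ he₁ he₂ hτe hρe g r a b hr F₁ F₂ hF₁ hF₂ => ?_⟩
  have hmain := hineq e₁ e₂ he₁ he₂ hτe hρe _ _ _ (norm_nonneg g) (norm_nonneg a)
    (norm_nonneg b)
  have hg := norm_nonneg g
  have ha := norm_nonneg a
  have hb := norm_nonneg b
  have hF₁n : ‖F₁‖ ≤ e₁ * (1 + c) * (‖g‖ + ‖a‖ + ‖b‖) := by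
    rw [hF₁, norm_neg, norm_smul, Real.norm_of_nonneg he₁.le, mul_assoc]
    refine mul_le_mul_of_nonneg_left ((norm_add_le _ _).trans ?_) he₁.le
    nlinarith [mul_nonneg hc hg]
  have i1 : inner ℝ g (P F₁) ≤ -(p * e₁ * ‖g‖ ^ 2) + C * e₁ * ‖g‖ * (‖a‖ + ‖b‖) := by
    have h1 : inner ℝ g (P F₁) = -e₁ * inner ℝ g (P g) - e₁ * inner ℝ g (P r) := by
      rw [hF₁]
      simp only [map_neg, map_smul, map_add, inner_neg_right, inner_smul_right, inner_add_right]
      ring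
    have h2 : -inner ℝ g (P r) ≤ C * ‖g‖ * (‖a‖ + ‖b‖) := by
      refine (neg_le_abs _).trans ((abs_real_inner_le_norm _ _).trans ?_)
      calc ‖g‖ * ‖P r‖ ≤ ‖g‖ * (‖P‖ * (c * (‖a‖ + ‖b‖))) :=
            mul_le_mul_of_nonneg_left ((P.le_opNorm r).trans
              (mul_le_mul_of_nonneg_left hr (norm_nonneg _))) hg
        _ = ‖P‖ * c * (‖g‖ * (‖a‖ + ‖b‖)) := by ring
        _ ≤ C * (‖g‖ * (‖a‖ + ‖b‖)) := mul_le_mul_of_nonneg_right k1 (by positivity)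
        _ = C * ‖g‖ * (‖a‖ + ‖b‖) := by ring
    have h3 := mul_le_mul_of_nonneg_left (hP g) he₁.le
    have h4 := mul_le_mul_of_nonneg_left h2 he₁.le
    rw [h1]
    linarith
  have i2 : 2 * inner ℝ (Q₂ a) (F₂ + M F₁) ≤ -(e₂ * ‖a‖ ^ 2) + C * e₂ * ‖a‖ * ‖b‖ +
      C * e₁ * ‖a‖ * (‖g‖ + ‖a‖ + ‖b‖) := by
    have h1 : 2 * inner ℝ (Q₂ a) (F₂ + M F₁) = -e₂ * (2 * inner ℝ (Q₂ a) (N a)) -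
        e₂ * (2 * inner ℝ (Q₂ a) (J b)) + 2 * inner ℝ (Q₂ a) (M F₁) := by
      rw [hF₂]
      simp only [inner_neg_right, inner_smul_right, inner_add_right]
      ring
    have h2 := mul_le_mul_of_nonneg_left (hQ₂ a) he₂.le
    have h3 : -(2 * inner ℝ (Q₂ a) (J b)) ≤ C * (‖a‖ * ‖b‖) :=
      (neg_le_abs _).trans ((abs_two_mul_inner_apply_le Q₂ J a b).trans
        (mul_le_mul_of_nonneg_right k2 (by positivity)))
    have h4 : 2 * inner ℝ (Q₂ a) (M F₁) ≤ C * e₁ * ‖a‖ * (‖g‖ + ‖a‖ + ‖b‖) := by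
      refine (le_abs_self _).trans ((abs_two_mul_inner_apply_le Q₂ M a F₁).trans ?_)
      calc 2 * ‖Q₂‖ * ‖M‖ * (‖a‖ * ‖F₁‖)
          ≤ 2 * ‖Q₂‖ * ‖M‖ * (‖a‖ * (e₁ * (1 + c) * (‖g‖ + ‖a‖ + ‖b‖))) := by gcongr
        _ = 2 * ‖Q₂‖ * ‖M‖ * (1 + c) * (e₁ * ‖a‖ * (‖g‖ + ‖a‖ + ‖b‖)) := by ring
        _ ≤ C * (e₁ * ‖a‖ * (‖g‖ + ‖a‖ + ‖b‖)) := by gcongr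
        _ = _ := by ring
    have h5 := mul_le_mul_of_nonneg_left h3 he₂.le
    rw [h1]
    linarith
  have i3 : 2 * inner ℝ (Q₃ b) (A b + T₁ F₁ + T₂ F₂) ≤ -‖b‖ ^ 2 +
      C * ‖b‖ * (e₁ * (‖g‖ + ‖a‖ + ‖b‖) + e₂ * (‖a‖ + ‖b‖)) := by
    have h1 : 2 * inner ℝ (Q₃ b) (A b + T₁ F₁ + T₂ F₂) = 2 * inner ℝ (Q₃ b) (A b) +
        2 * inner ℝ (Q₃ b) (T₁ F₁) - e₂ * (2 * inner ℝ (Q₃ b) ((T₂ ∘L N) a)) -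
        e₂ * (2 * inner ℝ (Q₃ b) ((T₂ ∘L J) b)) := by
      rw [hF₂]
      simp only [map_neg, map_smul, map_add, inner_neg_right, inner_smul_right, inner_add_right,
        ContinuousLinearMap.comp_apply]
      ring
    have h2 : 2 * inner ℝ (Q₃ b) (T₁ F₁) ≤ C * (e₁ * ‖b‖ * (‖g‖ + ‖a‖ + ‖b‖)) := by
      refine (le_abs_self _).trans ((abs_two_mul_inner_apply_le Q₃ T₁ b F₁).trans ?_)
      calc 2 * ‖Q₃‖ * ‖T₁‖ * (‖b‖ * ‖F₁‖)
          ≤ 2 * ‖Q₃‖ * ‖T₁‖ * (‖b‖ * (e₁ * (1 + c) * (‖g‖ + ‖a‖ + ‖b‖))) := by gcongr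
        _ = 2 * ‖Q₃‖ * ‖T₁‖ * (1 + c) * (e₁ * ‖b‖ * (‖g‖ + ‖a‖ + ‖b‖)) := by ring
        _ ≤ C * (e₁ * ‖b‖ * (‖g‖ + ‖a‖ + ‖b‖)) := by gcongr
    have h3 : e₂ * -(2 * inner ℝ (Q₃ b) ((T₂ ∘L N) a)) ≤ e₂ * (C * (‖b‖ * ‖a‖)) := by
      refine mul_le_mul_of_nonneg_left ((neg_le_abs _).trans
        ((abs_two_mul_inner_apply_le Q₃ (T₂ ∘L N) b a).trans
        (mul_le_mul_of_nonneg_right (le_trans ?_ k5) (by positivity)))) he₂.le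
      rw [mul_assoc _ ‖T₂‖]
      exact mul_le_mul_of_nonneg_left (ContinuousLinearMap.opNorm_comp_le _ _) (by positivity)
    have h4 : e₂ * -(2 * inner ℝ (Q₃ b) ((T₂ ∘L J) b)) ≤ e₂ * (C * (‖b‖ * ‖b‖)) := by
      refine mul_le_mul_of_nonneg_left ((neg_le_abs _).trans
        ((abs_two_mul_inner_apply_le Q₃ (T₂ ∘L J) b b).trans
        (mul_le_mul_of_nonneg_right (le_trans ?_ k6) (by positivity)))) he₂.le
      rw [mul_assoc _ ‖T₂‖]
      exact mul_le_mul_of_nonneg_left (ContinuousLinearMap.opNorm_comp_le _ _) (by positivity)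
    have h5 := hQ₃ b
    rw [h1]
    linarith
  linarith

end ThreeTimescale

/-! ### The composite Lyapunov function -/

open Metric NNReal in
/-- Quadratic bounds for a strongly convex function near a critical point. -/
theorem StrongConvexOn.bounds_near_critical {E : Type*} [NormedAddCommGroup E]
    [InnerProductSpace ℝ E] {D : Set E} {κ : ℝ} {Φ : E → ℝ} (hΦ : StrongConvexOn D κ Φ)
    {R : ℝ} (hR : 0 < R) (hD : ball 0 R ⊆ D) {G : E → E}
    (hG : ∀ ξ ∈ ball (0 : E) R, HasFDerivAt Φ (innerSL ℝ (G ξ)) ξ) (hG0 : G 0 = 0) {L : ℝ≥0}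
    (hL : LipschitzOnWith L G (ball 0 R)) {ξ : E} (hξ : ξ ∈ ball (0 : E) R) :
    κ / 2 * ‖ξ‖ ^ 2 ≤ Φ ξ - Φ 0 ∧ κ / 2 * ‖ξ‖ ^ 2 + (Φ ξ - Φ 0) ≤ L * ‖ξ‖ ^ 2 ∧
      κ * ‖ξ‖ ≤ ‖G ξ‖ := by
  have h0 : (0 : E) ∈ ball (0 : E) R := mem_ball_self hR
  -- The first-order inequality is used from `0` to `ξ` and back; the sum is strong monotonicity `κ
  -- ‖ξ‖² ≤ ⟨G ξ, ξ⟩`.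
  have h1 := hΦ.add_fderiv_add_sq_le (hD h0) (hD hξ) (hG 0 h0)
  have h2 := hΦ.add_fderiv_add_sq_le (hD hξ) (hD h0) (hG ξ hξ)
  simp only [hG0, map_zero, _root_.zero_apply, add_zero, sub_zero, zero_sub,
    map_neg, innerSL_apply_apply, norm_neg] at h1 h2
  have h3 : inner ℝ (G ξ) ξ ≤ ‖G ξ‖ * ‖ξ‖ := real_inner_le_norm _ _
  have h4 : ‖G ξ‖ ≤ L * ‖ξ‖ := by
    simpa [hG0, dist_eq_norm] using hL.dist_le_mul ξ hξ 0 h0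
  have hn := norm_nonneg ξ
  refine ⟨by linarith, by nlinarith, ?_⟩
  rcases hn.eq_or_lt with h | h
  · rw [← h, mul_zero]
    exact norm_nonneg _
  · refine le_of_mul_le_mul_right ?_ h
    nlinarith

theorem inner_apply_le_of_comp {X Y : Type*} [NormedAddCommGroup X] [NormedSpace ℝ X]
    [NormedAddCommGroup Y] [InnerProductSpace ℝ Y] (Q : Y →L[ℝ] Y) (T : X →L[ℝ] Y) (d : X) :
    inner ℝ (Q (T d)) (T d) ≤ ‖Q‖ * ‖T‖ ^ 2 * ‖d‖ ^ 2 := by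
  have h1 := T.le_opNorm d
  calc inner ℝ (Q (T d)) (T d) ≤ ‖Q (T d)‖ * ‖T d‖ := real_inner_le_norm _ _
    _ ≤ (‖Q‖ * ‖T d‖) * ‖T d‖ := by
        gcongr
        exact Q.le_opNorm _
    _ ≤ (‖Q‖ * (‖T‖ * ‖d‖)) * (‖T‖ * ‖d‖) := by gcongr
    _ = _ := by ring

section ThreeTimescale

variable {X E H : Type*} [NormedAddCommGroup X] [InnerProductSpace ℝ X]
  [NormedAddCommGroup E] [InnerProductSpace ℝ E]
  [NormedAddCommGroup H] [InnerProductSpace ℝ H]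

/-- The slow coordinate `P η₁`. -/
def slowCoord (P : E →L[ℝ] E) : X × E × H →L[ℝ] E :=
  P ∘L ContinuousLinearMap.fst ℝ E H ∘L ContinuousLinearMap.snd ℝ X (E × H)

/-- The deviation `η₂ + M η₁` of the intermediate variable from its quasi-steady state. -/
def midCoord (M : E →L[ℝ] H) : X × E × H →L[ℝ] H :=
  (ContinuousLinearMap.snd ℝ E H + M ∘L ContinuousLinearMap.fst ℝ E H) ∘L
    ContinuousLinearMap.snd ℝ X (E × H)

/-- The deviation `x + T₁ η₁ + T₂ η₂` of the fast variable from its quasi-steady state. -/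
def fastCoord (T₁ : E →L[ℝ] X) (T₂ : H →L[ℝ] X) : X × E × H →L[ℝ] X :=
  ContinuousLinearMap.fst ℝ X (E × H) + (T₁ ∘L ContinuousLinearMap.fst ℝ E H +
    T₂ ∘L ContinuousLinearMap.snd ℝ E H) ∘L ContinuousLinearMap.snd ℝ X (E × H)

@[simp] theorem slowCoord_apply (P : E →L[ℝ] E) (d : X × E × H) : slowCoord P d = P d.2.1 := rfl

@[simp] theorem midCoord_apply (M : E →L[ℝ] H) (d : X × E × H) :
    midCoord M d = d.2.2 + M d.2.1 := rfl

@[simp] theorem fastCoord_apply (T₁ : E →L[ℝ] X) (T₂ : H →L[ℝ] X) (d : X × E × H) :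
    fastCoord T₁ T₂ d = d.1 + (T₁ d.2.1 + T₂ d.2.2) := rfl

theorem hasFDerivAt_quadraticForm {Q : X →L[ℝ] X}
    (hQ : ∀ v v', inner ℝ (Q v) v' = inner ℝ v (Q v')) (v : X) :
    HasFDerivAt (fun v => inner ℝ (Q v) v) ((2 : ℝ) • innerSL ℝ (Q v)) v := by
  refine ((Q.hasFDerivAt (x := v)).inner ℝ (hasFDerivAt_id v)).congr_fderiv
    (ContinuousLinearMap.ext fun h => ?_)
  have h1 := hQ h v
  have h2 := real_inner_comm (Q v) h
  simp
  linarith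

variable [FiniteDimensional ℝ X] [FiniteDimensional ℝ E] [FiniteDimensional ℝ H]

/-- The change of coordinates is triangular with injective diagonal blocks `P`, `1`, `1`, hence
bounded below in finite dimension. -/
theorem exists_norm_sq_le_coords {P : E →L[ℝ] E} (hP : Function.Injective P) (M : E →L[ℝ] H)
    (T₁ : E →L[ℝ] X) (T₂ : H →L[ℝ] X) :
    ∃ k > (0 : ℝ), ∀ d : X × E × H, ‖d‖ ^ 2 ≤ k * (‖slowCoord P d‖ ^ 2 + ‖midCoord M d‖ ^ 2 +
      ‖fastCoord T₁ T₂ d‖ ^ 2) := by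
  let Θ : X × E × H →L[ℝ] E × H × X :=
    (slowCoord P).prod ((midCoord M).prod (fastCoord T₁ T₂))
  have hker : LinearMap.ker (Θ : X × E × H →ₗ[ℝ] E × H × X) = ⊥ := by
    rw [LinearMap.ker_eq_bot']
    rintro ⟨x, e, h⟩ hd
    have h1 : slowCoord P ((x, e, h) : X × E × H) = 0 := congrArg Prod.fst hd
    have h2 : midCoord M ((x, e, h) : X × E × H) = 0 := congrArg (fun y => y.2.1) hd
    have h3 : fastCoord T₁ T₂ ((x, e, h) : X × E × H) = 0 := congrArg (fun y => y.2.2) hd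
    rw [slowCoord_apply] at h1
    have he : e = 0 := hP (h1.trans (map_zero P).symm)
    subst he
    simp only [midCoord_apply, map_zero, add_zero] at h2
    subst h2
    simp only [fastCoord_apply, map_zero, add_zero] at h3
    subst h3
    rfl
  obtain ⟨K, hK, hKl⟩ := LinearMap.exists_antilipschitzWith _ hker
  refine ⟨K ^ 2, by positivity, fun d => ?_⟩
  have h1 : ‖d‖ ≤ K * ‖Θ d‖ := by
    simpa [dist_eq_norm] using hKl.le_mul_dist d 0
  have h2 : ‖Θ d‖ ^ 2 ≤ ‖slowCoord P d‖ ^ 2 + ‖midCoord M d‖ ^ 2 + ‖fastCoord T₁ T₂ d‖ ^ 2 := by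
    have e1 : ‖Θ d‖ = max ‖slowCoord P d‖ (max ‖midCoord M d‖ ‖fastCoord T₁ T₂ d‖) := rfl
    rw [e1]
    have hmax : ∀ x y : ℝ, (max x y) ^ 2 ≤ x ^ 2 + y ^ 2 := fun x y => by
      rcases max_choice x y with h | h <;> rw [h] <;> nlinarith [sq_nonneg x, sq_nonneg y]
    rw [add_assoc]
    exact (hmax _ _).trans (add_le_add_right (hmax _ _) _)
  calc ‖d‖ ^ 2 ≤ (K * ‖Θ d‖) ^ 2 := by gcongr
    _ = K ^ 2 * ‖Θ d‖ ^ 2 := by ring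
    _ ≤ _ := by gcongr

-- The assumed inequality bounds the derivative of `Φ(ξ) - Φ(0) + ⟨Q₂ a, a⟩ + ⟨Q₃ b, b⟩` along `F`.
-- It is in terms of the gradient norm; `hgrad` converts it to `‖ξ‖`, so the modulus `κ` affects
-- only the decay rate and the quadratic bounds.
open Metric NNReal in
theorem isLocallyExpStable_of_three_timescale_dissipation {F : X × E × H → X × E × H}
    {Ω : Set (X × E × H)} {p : X × E × H} {R : ℝ} (hR : 0 < R) (hΩ : ball p R ⊆ Ω) {K : ℝ≥0}
    (hF : LipschitzOnWith K F (ball p R)) {P : E →L[ℝ] E} (hP : Function.Injective P)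
    (M : E →L[ℝ] H) (T₁ : E →L[ℝ] X) (T₂ : H →L[ℝ] X) {Q₂ : H →L[ℝ] H} {Q₃ : X →L[ℝ] X}
    (hQ₂ : ∀ v v', inner ℝ (Q₂ v) v' = inner ℝ v (Q₂ v')) {c₂ : ℝ} (hc₂ : 0 < c₂)
    (hQ₂' : ∀ v, c₂ * ‖v‖ ^ 2 ≤ inner ℝ (Q₂ v) v)
    (hQ₃ : ∀ v v', inner ℝ (Q₃ v) v' = inner ℝ v (Q₃ v')) {c₃ : ℝ} (hc₃ : 0 < c₃)
    (hQ₃' : ∀ v, c₃ * ‖v‖ ^ 2 ≤ inner ℝ (Q₃ v) v)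
    {Φ : E → ℝ} {G : E → E} {κ ℓ : ℝ} (hκ : 0 < κ)
    (hΦ : ∀ s ∈ ball p R, HasFDerivAt Φ (innerSL ℝ (G (slowCoord P (s - p))))
      (slowCoord P (s - p)))
    (hlow : ∀ s ∈ ball p R, κ / 2 * ‖slowCoord P (s - p)‖ ^ 2 ≤ Φ (slowCoord P (s - p)) - Φ 0)
    (hup : ∀ s ∈ ball p R, Φ (slowCoord P (s - p)) - Φ 0 ≤ ℓ * ‖slowCoord P (s - p)‖ ^ 2)
    (hgrad : ∀ s ∈ ball p R, κ * ‖slowCoord P (s - p)‖ ≤ ‖G (slowCoord P (s - p))‖)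
    {k₁ k₂ k₃ : ℝ} (hk₁ : 0 < k₁) (hk₂ : 0 < k₂) (hk₃ : 0 < k₃)
    (hdiss : ∀ s ∈ ball p R, inner ℝ (G (slowCoord P (s - p))) (slowCoord P (F s)) +
      2 * inner ℝ (Q₂ (midCoord M (s - p))) (midCoord M (F s)) +
      2 * inner ℝ (Q₃ (fastCoord T₁ T₂ (s - p))) (fastCoord T₁ T₂ (F s)) ≤
      -(k₁ * ‖G (slowCoord P (s - p))‖ ^ 2 + k₂ * ‖midCoord M (s - p)‖ ^ 2 +
        k₃ * ‖fastCoord T₁ T₂ (s - p)‖ ^ 2)) :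
    IsLocallyExpStable F Ω p := by
  obtain ⟨k, hk, hcoord⟩ := exists_norm_sq_le_coords hP M T₁ T₂
  set ξ : X × E × H →L[ℝ] E := slowCoord P
  set a : X × E × H →L[ℝ] H := midCoord M
  set b : X × E × H →L[ℝ] X := fastCoord T₁ T₂
  let V : X × E × H → ℝ := fun s => (Φ (ξ (s - p)) - Φ 0) + inner ℝ (Q₂ (a (s - p))) (a (s - p)) +
    inner ℝ (Q₃ (b (s - p))) (b (s - p))
  let V' : X × E × H → (X × E × H →L[ℝ] ℝ) := fun s => innerSL ℝ (G (ξ (s - p))) ∘L ξ +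
    ((2 : ℝ) • innerSL ℝ (Q₂ (a (s - p)))) ∘L a + ((2 : ℝ) • innerSL ℝ (Q₃ (b (s - p)))) ∘L b
  have hξ : ∀ s, HasFDerivAt (fun s => ξ (s - p)) ξ s := fun s =>
    ξ.hasFDerivAt.comp s ((hasFDerivAt_id s).sub_const p)
  have ha : ∀ s, HasFDerivAt (fun s => a (s - p)) a s := fun s =>
    a.hasFDerivAt.comp s ((hasFDerivAt_id s).sub_const p)
  have hb : ∀ s, HasFDerivAt (fun s => b (s - p)) b s := fun s =>
    b.hasFDerivAt.comp s ((hasFDerivAt_id s).sub_const p)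
  have hV : ∀ s ∈ ball p R, HasFDerivAt V (V' s) s := by
    intro s hs
    have h1 : HasFDerivAt (fun s => Φ (ξ (s - p)) - Φ 0) (innerSL ℝ (G (ξ (s - p))) ∘L ξ) s :=
      ((hΦ s hs).comp s (hξ s)).sub_const (Φ 0)
    have h2 : HasFDerivAt (fun s => inner ℝ (Q₂ (a (s - p))) (a (s - p)))
        (((2 : ℝ) • innerSL ℝ (Q₂ (a (s - p)))) ∘L a) s :=
      HasFDerivAt.comp (g := fun v => inner ℝ (Q₂ v) v) s
        (hasFDerivAt_quadraticForm hQ₂ (a (s - p))) (ha s)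
    have h3 : HasFDerivAt (fun s => inner ℝ (Q₃ (b (s - p))) (b (s - p)))
        (((2 : ℝ) • innerSL ℝ (Q₃ (b (s - p)))) ∘L b) s :=
      HasFDerivAt.comp (g := fun v => inner ℝ (Q₃ v) v) s
        (hasFDerivAt_quadraticForm hQ₃ (b (s - p))) (hb s)
    exact (h1.add h2).add h3
  have hlow' : ∀ s ∈ ball p R, min (κ / 2) (min c₂ c₃) / k * ‖s - p‖ ^ 2 ≤ V s := by
    intro s hs
    have h1 := hcoord (s - p)
    have m1 : min (κ / 2) (min c₂ c₃) ≤ κ / 2 := min_le_left _ _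
    have m2 : min (κ / 2) (min c₂ c₃) ≤ c₂ := (min_le_right _ _).trans (min_le_left _ _)
    have m3 : min (κ / 2) (min c₂ c₃) ≤ c₃ := (min_le_right _ _).trans (min_le_right _ _)
    have hm : 0 < min (κ / 2) (min c₂ c₃) := by positivity
    set μ := min (κ / 2) (min c₂ c₃)
    have h2 : μ / k * ‖s - p‖ ^ 2 ≤ μ * ‖ξ (s - p)‖ ^ 2 + μ * ‖a (s - p)‖ ^ 2 +
        μ * ‖b (s - p)‖ ^ 2 := by
      have := mul_le_mul_of_nonneg_left h1 (div_pos hm hk).le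
      rw [← mul_assoc, div_mul_cancel₀ _ hk.ne'] at this
      linarith
    have h3 := mul_le_mul_of_nonneg_right m1 (sq_nonneg ‖ξ (s - p)‖)
    have h4 := mul_le_mul_of_nonneg_right m2 (sq_nonneg ‖a (s - p)‖)
    have h5 := mul_le_mul_of_nonneg_right m3 (sq_nonneg ‖b (s - p)‖)
    have := hlow s hs
    have := hQ₂' (a (s - p))
    have := hQ₃' (b (s - p))
    simp only [V]
    linarith
  have hup' : ∀ s ∈ ball p R, V s ≤ (|ℓ| * ‖ξ‖ ^ 2 + ‖Q₂‖ * ‖a‖ ^ 2 + ‖Q₃‖ * ‖b‖ ^ 2 + 1) *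
      ‖s - p‖ ^ 2 := by
    intro s hs
    have h1 : Φ (ξ (s - p)) - Φ 0 ≤ |ℓ| * ‖ξ‖ ^ 2 * ‖s - p‖ ^ 2 := by
      refine (hup s hs).trans ((mul_le_mul_of_nonneg_right (le_abs_self ℓ) (sq_nonneg _)).trans ?_)
      rw [mul_assoc, ← mul_pow]
      gcongr
      exact ξ.le_opNorm _
    have h2 := inner_apply_le_of_comp Q₂ a (s - p)
    have h3 := inner_apply_le_of_comp Q₃ b (s - p)
    have := sq_nonneg ‖s - p‖
    simp only [V]
    linarith
  have hdec : ∀ s ∈ ball p R, V' s (F s) ≤ -(min (k₁ * κ ^ 2) (min k₂ k₃) / k) * ‖s - p‖ ^ 2 := by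
    intro s hs
    have h1 := hcoord (s - p)
    have m1 : min (k₁ * κ ^ 2) (min k₂ k₃) ≤ k₁ * κ ^ 2 := min_le_left _ _
    have m2 : min (k₁ * κ ^ 2) (min k₂ k₃) ≤ k₂ := (min_le_right _ _).trans (min_le_left _ _)
    have m3 : min (k₁ * κ ^ 2) (min k₂ k₃) ≤ k₃ := (min_le_right _ _).trans (min_le_right _ _)
    have hm : 0 < min (k₁ * κ ^ 2) (min k₂ k₃) := by positivity
    set μ := min (k₁ * κ ^ 2) (min k₂ k₃)
    have h2 : μ / k * ‖s - p‖ ^ 2 ≤ μ * ‖ξ (s - p)‖ ^ 2 + μ * ‖a (s - p)‖ ^ 2 +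
        μ * ‖b (s - p)‖ ^ 2 := by
      have := mul_le_mul_of_nonneg_left h1 (div_pos hm hk).le
      rw [← mul_assoc, div_mul_cancel₀ _ hk.ne'] at this
      linarith
    have h3 := mul_le_mul_of_nonneg_right m1 (sq_nonneg ‖ξ (s - p)‖)
    have h4 := mul_le_mul_of_nonneg_right m2 (sq_nonneg ‖a (s - p)‖)
    have h5 := mul_le_mul_of_nonneg_right m3 (sq_nonneg ‖b (s - p)‖)
    have h6 : κ ^ 2 * ‖ξ (s - p)‖ ^ 2 ≤ ‖G (ξ (s - p))‖ ^ 2 := by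
      rw [← mul_pow]
      exact pow_le_pow_left₀ (by positivity) (hgrad s hs) 2
    have h7 := mul_le_mul_of_nonneg_left h6 hk₁.le
    have h8 := hdiss s hs
    have h9 : V' s (F s) = inner ℝ (G (ξ (s - p))) (ξ (F s)) +
        2 * inner ℝ (Q₂ (a (s - p))) (a (F s)) + 2 * inner ℝ (Q₃ (b (s - p))) (b (F s)) := rfl
    rw [h9]
    linarith
  exact isLocallyExpStable_of_lyapunov hR hΩ hF (by positivity) (by positivity) (by positivity)
    hV hlow' hup' hdec

end ThreeTimescale

/-! ### Definite matrices and the controller gains -/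

theorem Matrix.PosDef.exists_mul_norm_sq_le_inner {q : ℕ} {P : Matrix (Fin q) (Fin q) ℝ}
    (hP : P.PosDef) : ∃ p > (0 : ℝ), ∀ v : Vec q, p * ‖v‖ ^ 2 ≤ inner ℝ v (P *ₑ v) := by
  have hpos : ∀ v : Vec q, v ≠ 0 → 0 < inner ℝ v (P *ₑ v) := by
    intro v hv
    have hv' : v.ofLp ≠ 0 := fun h => hv (WithLp.ofLp_injective _ h)
    have h1 := hP.dotProduct_mulVec_pos hv'
    have h2 := Matrix.inner_toEuclideanCLM P v v
    have h3 : inner ℝ v (P *ₑ v) = v.ofLp ⬝ᵥ P *ᵥ v.ofLp := h2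
    rw [h3]
    simpa using h1
  have hcont : Continuous fun v : Vec q => inner ℝ v (P *ₑ v) := by
    have : Continuous fun v : Vec q => matCLM P v := (matCLM P).continuous
    exact continuous_id.inner this
  -- The sphere is empty exactly when `q = 0`; otherwise the minimum of the form on it serves as
  -- `p`.
  rcases (Metric.sphere (0 : Vec q) 1).eq_empty_or_nonempty with h | h
  · refine ⟨1, one_pos, fun v => ?_⟩
    have hv : v = 0 := by
      by_contra hv
      have : (‖v‖⁻¹ • v) ∈ Metric.sphere (0 : Vec q) 1 := by
        simp [norm_smul, hv]
      rw [h] at this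
      exact this
    simp [hv]
  · obtain ⟨x, hx, hmin⟩ := (isCompact_sphere (0 : Vec q) 1).exists_isMinOn h hcont.continuousOn
    have hx0 : x ≠ 0 := Metric.ne_of_mem_sphere hx one_ne_zero
    refine ⟨_, hpos x hx0, fun v => ?_⟩
    by_cases hv : v = 0
    · simp [hv]
    · have hv' : 0 < ‖v‖ := norm_pos_iff.2 hv
      have h1 := hmin (show ‖v‖⁻¹ • v ∈ Metric.sphere (0 : Vec q) 1 by simp [norm_smul, hv])
      simp only [Set.mem_ofPred_eq] at h1
      rw [matAct_smul, inner_smul_left, inner_smul_right] at h1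
      have h2 := mul_le_mul_of_nonneg_right h1 (sq_nonneg ‖v‖)
      have h3 : (starRingEnd ℝ) ‖v‖⁻¹ * (‖v‖⁻¹ * inner ℝ v (P *ₑ v)) * ‖v‖ ^ 2 =
          inner ℝ v (P *ₑ v) := by
        simp
        field_simp
      rwa [h3] at h2

theorem Matrix.nonsing_inv_matAct {k : ℕ} {M : Matrix (Fin k) (Fin k) ℝ} (hM : IsUnit M)
    (v : Vec k) : M⁻¹ *ₑ (M *ₑ v) = v := by
  rw [← matAct_mul, Matrix.nonsing_inv_mul _ ((Matrix.isUnit_iff_isUnit_det _).1 hM), matAct_one]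

theorem Matrix.matAct_nonsing_inv {k : ℕ} {M : Matrix (Fin k) (Fin k) ℝ} (hM : IsUnit M)
    (v : Vec k) : M *ₑ (M⁻¹ *ₑ v) = v := by
  rw [← matAct_mul, Matrix.mul_nonsing_inv _ ((Matrix.isUnit_iff_isUnit_det _).1 hM), matAct_one]

section Gains

variable {n m r nw nc q : ℕ} {S : Plant n m r nw} {O : OSSData m r nw nc}
  {Tz : Matrix (Fin r) (Fin q) ℝ} {Tu : Matrix (Fin m) (Fin q) ℝ}
  {K₁ : Matrix (Fin m) (Fin q) ℝ} {K₂ : Matrix (Fin m) (Fin nc) ℝ} {P : Matrix (Fin q) (Fin q) ℝ}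

/-- With `Π_c K₁ = T_u P`, the input splits into a part along the feasible directions and the
range of `K₂`. -/
theorem gain_splitting (hK₁ : projC (constraintGain S O) K₂ * K₁ = Tu * P) (e : Vec q)
    (h : Vec nc) :
    K₁ *ₑ e + K₂ *ₑ h = Tu *ₑ (P *ₑ e) +
      K₂ *ₑ (h + ((constraintGain S O * K₂)⁻¹ * (constraintGain S O * K₁)) *ₑ e) := by
  have h1 := congrArg (fun X => X *ₑ e) hK₁
  simp only [projC, matAct_mul, matAct_sub_matrix, matAct_one] at h1
  rw [← h1, matAct_add, matAct_mul, matAct_mul]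
  abel

/-- Applying `N` to the split input kills the `T_u` part and isolates `N K₂ a`; once `a = 0`,
injectivity of `T_u P` finishes. -/
theorem gain_injective (hT : SpansFeasibleSubspace S O Tz Tu)
    (hTrank : (Matrix.fromRows Tz Tu).rank = q) (hNK : IsUnit (constraintGain S O * K₂))
    (hP : IsUnit P) (hK₁ : projC (constraintGain S O) K₂ * K₁ = Tu * P) {e e' : Vec q}
    {h h' : Vec nc} (heq : K₁ *ₑ e + K₂ *ₑ h = K₁ *ₑ e' + K₂ *ₑ h') : e = e' ∧ h = h' := by
  have key : ∀ (e : Vec q) (h : Vec nc), K₁ *ₑ e + K₂ *ₑ h = 0 → e = 0 ∧ h = 0 := by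
    intro e h heq
    rw [gain_splitting hK₁] at heq
    set a := h + ((constraintGain S O * K₂)⁻¹ * (constraintGain S O * K₁)) *ₑ e with ha
    have h1 := congrArg (fun v => constraintGain S O *ₑ v) heq
    simp only [matAct_add, hT.constraintGain_Tu, zero_add, matAct_zero] at h1
    rw [← matAct_mul] at h1
    have ha0 : a = 0 := by
      rw [← Matrix.nonsing_inv_matAct hNK a, h1, matAct_zero]
    rw [ha0, matAct_zero, add_zero] at heq
    have hPe : P *ₑ e = 0 := hT.Tu_injective hTrank (by rw [heq, matAct_zero])
    have he : e = 0 := by rw [← Matrix.nonsing_inv_matAct hP e, hPe, matAct_zero]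
    refine ⟨he, ?_⟩
    rw [he, matAct_zero, add_zero] at ha
    rw [← ha, ha0]
  have := key (e - e') (h - h') (by
    rw [matAct_sub, matAct_sub]
    linear_combination (norm := module) heq)
  exact ⟨sub_eq_zero.1 this.1, sub_eq_zero.1 this.2⟩

/-- Subtracting `K₂ (N K₂)⁻¹ N u` from `u` leaves a vector in the null space of `N`, which is the
range of `T_u`. -/
theorem gain_surjective (hT : SpansFeasibleSubspace S O Tz Tu)
    (hNK : IsUnit (constraintGain S O * K₂)) (hP : IsUnit P)
    (hK₁ : projC (constraintGain S O) K₂ * K₁ = Tu * P) (u : Vec m) :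
    ∃ (e : Vec q) (h : Vec nc), K₁ *ₑ e + K₂ *ₑ h = u := by
  let a : Vec nc := (constraintGain S O * K₂)⁻¹ *ₑ (constraintGain S O *ₑ u)
  have h0 : constraintGain S O *ₑ (u - K₂ *ₑ a) = 0 := by
    rw [matAct_sub, ← matAct_mul, Matrix.matAct_nonsing_inv hNK, sub_self]
  obtain ⟨ξ, hξ⟩ := hT.exists_of_constraintGain_eq_zero h0
  refine ⟨P⁻¹ *ₑ ξ, a - ((constraintGain S O * K₂)⁻¹ * (constraintGain S O * K₁)) *ₑ (P⁻¹ *ₑ ξ),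
    ?_⟩
  rw [gain_splitting hK₁, Matrix.matAct_nonsing_inv hP, hξ, sub_add_cancel, sub_add_cancel]

theorem exists_stabilizing_gain (hN : (constraintGain S O).rank = nc) :
    ∃ K₂ : Matrix (Fin m) (Fin nc) ℝ, IsHurwitz (-(constraintGain S O * K₂)) := by
  obtain ⟨R, hR⟩ := Matrix.exists_right_inverse_of_rank_eq hN
  refine ⟨R, fun s hs => ?_⟩
  rw [hR, spectrum.mem_iff] at hs
  have h1 : algebraMap ℂ (Matrix (Fin nc) (Fin nc) ℂ) s -
      (-(1 : Matrix (Fin nc) (Fin nc) ℝ)).map (algebraMap ℝ ℂ) =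
      algebraMap ℂ (Matrix (Fin nc) (Fin nc) ℂ) (s + 1) := by
    have h2 : (-(1 : Matrix (Fin nc) (Fin nc) ℝ)).map (algebraMap ℝ ℂ) = -1 := by
      have := map_neg (algebraMap ℝ ℂ).mapMatrix (1 : Matrix (Fin nc) (Fin nc) ℝ)
      simpa only [map_one, RingHom.mapMatrix_apply] using this
    rw [h2, map_add, map_one, sub_neg_eq_add]
  rw [h1] at hs
  have h2 : s + 1 = 0 := by
    by_contra h
    exact hs ((isUnit_iff_ne_zero.2 h).map _)
  rw [eq_neg_of_add_eq_zero_left h2]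
  norm_num

/-- `K₁ = T_u P` works: `N T_u = 0`, so `Π_c` fixes the range of `T_u`. -/
theorem exists_slow_gain (hT : SpansFeasibleSubspace S O Tz Tu)
    (hTrank : (Matrix.fromRows Tz Tu).rank = q) (hP : IsUnit P) :
    ∃ K₁ : Matrix (Fin m) (Fin q) ℝ,
      K₁.rank = q ∧ projC (constraintGain S O) K₂ * K₁ = Tu * P := by
  refine ⟨Tu * P, Matrix.rank_eq_of_mulVec_injective fun x y hxy => ?_,
    Matrix.ext_matAct fun v => ?_⟩
  · have h1 : (Tu * P) *ₑ (WithLp.toLp 2 x) = (Tu * P) *ₑ (WithLp.toLp 2 y) :=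
      congrArg (WithLp.toLp 2) hxy
    rw [matAct_mul, matAct_mul] at h1
    have h2 := hT.Tu_injective hTrank h1
    have h3 := congrArg (fun v => P⁻¹ *ₑ v) h2
    simp only [Matrix.nonsing_inv_matAct hP] at h3
    exact congrArg WithLp.ofLp h3
  · simp only [projC, matAct_mul, matAct_sub_matrix, matAct_one, hT.constraintGain_Tu,
      matAct_zero, sub_zero]

/-- The output of the plant in equilibrium. -/
theorem Plant.output_eq_of_equilibrium (hA : IsUnit S.A) {x : Vec n} {u : Vec m} {w : Vec nw}
    (hx : S.A *ₑ x + S.B *ₑ u + S.Bw *ₑ w = 0) :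
    S.C *ₑ x + S.D *ₑ u + S.Dw *ₑ w = S.Gu *ₑ u + S.Gw *ₑ w := by
  have h1 := congrArg (fun v => S.C *ₑ (S.A⁻¹ *ₑ v)) hx
  simp only [matAct_add, Matrix.nonsing_inv_matAct hA, matAct_zero] at h1
  simp only [Plant.Gu, Plant.Gw, matAct_add_matrix, matAct_neg_matrix, matAct_mul]
  linear_combination (norm := module) h1

end Gains

/-! ### Critical points of the reduced objective -/

section ReducedProblem

variable {n m r nw nc q : ℕ} {S : Plant n m r nw} {O : OSSData m r nw nc}
  {Tz : Matrix (Fin r) (Fin q) ℝ} {Tu : Matrix (Fin m) (Fin q) ℝ}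

/-- The gradient of the reduced objective `ξ ↦ f₀ (u + T_u ξ) + g₀ (z + T_z ξ)`. -/
noncomputable def reducedGradient (O : OSSData m r nw nc) (Tz : Matrix (Fin r) (Fin q) ℝ)
    (Tu : Matrix (Fin m) (Fin q) ℝ) (z : Vec r) (u : Vec m) (ξ : Vec q) : Vec q :=
  Tuᵀ *ₑ gradient O.f₀ (u + Tu *ₑ ξ) + Tzᵀ *ₑ gradient O.g₀ (z + Tz *ₑ ξ)

theorem HasFDerivAt.comp_add_matAct {a b : ℕ} {f : Vec a → ℝ} {M : Matrix (Fin a) (Fin b) ℝ}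
    {u : Vec a} {ξ : Vec b} (hf : DifferentiableAt ℝ f (u + M *ₑ ξ)) :
    HasFDerivAt (fun ξ : Vec b => f (u + M *ₑ ξ))
      (innerSL ℝ (Mᵀ *ₑ gradient f (u + M *ₑ ξ))) ξ := by
  have h1 := hf.hasGradientAt.hasFDerivAt
  have h2 : HasFDerivAt (fun ξ : Vec b => u + M *ₑ ξ) (matCLM M) ξ :=
    (matCLM M).hasFDerivAt.const_add u
  refine (HasFDerivAt.comp (g := f) ξ h1 h2).congr_fderiv (ContinuousLinearMap.ext fun v => ?_)
  rw [innerSL_apply_apply, inner_transpose_matAct]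
  rfl

theorem StandingAssumptions.hasFDerivAt_reduced (hO : StandingAssumptions S O) {z : Vec r}
    {u : Vec m} {ξ : Vec q} (hu : u + Tu *ₑ ξ ∈ interior O.U) (hz : z + Tz *ₑ ξ ∈ interior O.Z) :
    HasFDerivAt (fun ξ : Vec q => O.f₀ (u + Tu *ₑ ξ) + O.g₀ (z + Tz *ₑ ξ))
      (innerSL ℝ (reducedGradient O Tz Tu z u ξ)) ξ := by
  have hf : DifferentiableAt ℝ O.f₀ (u + Tu *ₑ ξ) :=
    (hO.contDiffOn_f₀.differentiableOn one_ne_zero).differentiableAt (isOpen_interior.mem_nhds hu)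
  have hg : DifferentiableAt ℝ O.g₀ (z + Tz *ₑ ξ) :=
    (hO.contDiffOn_g₀.differentiableOn one_ne_zero).differentiableAt (isOpen_interior.mem_nhds hz)
  rw [reducedGradient, map_add]
  exact (HasFDerivAt.comp_add_matAct hf).add (HasFDerivAt.comp_add_matAct hg)

open Filter Topology in
theorem IsOptimal.reducedGradient_eq_zero (hT : SpansFeasibleSubspace S O Tz Tu)
    (hO : StandingAssumptions S O) {w : Vec nw} {z : Vec r} {u : Vec m}
    (hopt : IsOptimal S O w z u) (hz : z ∈ interior O.Z) (hu : u ∈ interior O.U) :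
    reducedGradient O Tz Tu z u 0 = 0 := by
  have hu0 : u + Tu *ₑ (0 : Vec q) ∈ interior O.U := by simpa [matAct_zero] using hu
  have hz0 : z + Tz *ₑ (0 : Vec q) ∈ interior O.Z := by simpa [matAct_zero] using hz
  have hd := hO.hasFDerivAt_reduced hu0 hz0
  have hcu : Continuous fun ξ : Vec q => u + matCLM Tu ξ := by fun_prop
  have hcz : Continuous fun ξ : Vec q => z + matCLM Tz ξ := by fun_prop
  have hmin : IsLocalMin (fun ξ : Vec q => O.f₀ (u + Tu *ₑ ξ) + O.g₀ (z + Tz *ₑ ξ)) 0 := by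
    filter_upwards [hcu.continuousAt.eventually (isOpen_interior.mem_nhds hu0),
      hcz.continuousAt.eventually (isOpen_interior.mem_nhds hz0)] with ξ h1 h2
    simp only [matAct_zero, add_zero]
    exact hopt.2 _ _ ⟨interior_subset h2, interior_subset h1, hopt.1.2.2.add hT ξ⟩
  have h1 := hmin.hasFDerivAt_eq_zero hd
  have h2 := congrArg (fun T : Vec q →L[ℝ] ℝ => T (reducedGradient O Tz Tu z u 0)) h1
  simpa using h2

/-- At a critical point, strong convexity forces the optimal value to exceed the value there by `κ /
2 * ‖ξ‖ ^ 2`, with `ξ` the displacement to the optimum. -/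
theorem eq_of_reducedGradient_eq_zero (hT : SpansFeasibleSubspace S O Tz Tu)
    (hO : StandingAssumptions S O) {w : Vec nw} {z z' : Vec r} {u u' : Vec m}
    (hopt : IsOptimal S O w z u) (hz' : z' ∈ interior O.Z) (hu' : u' ∈ interior O.U)
    (h' : SteadyStateConstraints S O w z' u') (hgrad : reducedGradient O Tz Tu z' u' 0 = 0)
    {κ : ℝ} (hκ : 0 < κ)
    (hconv : StrongConvexOn {ξ : Vec q | u' + Tu *ₑ ξ ∈ O.U ∧ z' + Tz *ₑ ξ ∈ O.Z} κ
        (fun ξ => O.f₀ (u' + Tu *ₑ ξ) + O.g₀ (z' + Tz *ₑ ξ))) : z' = z ∧ u' = u := by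
  obtain ⟨ξ, rfl, rfl⟩ := h'.exists_eq_add hT hopt.1.2.2
  have hu0 : u' + Tu *ₑ (0 : Vec q) ∈ interior O.U := by simpa [matAct_zero] using hu'
  have hz0 : z' + Tz *ₑ (0 : Vec q) ∈ interior O.Z := by simpa [matAct_zero] using hz'
  have h1 := hconv.add_fderiv_add_sq_le (x := 0) (y := ξ)
    ⟨interior_subset hu0, interior_subset hz0⟩ ⟨hopt.1.2.1, hopt.1.1⟩
    (hO.hasFDerivAt_reduced hu0 hz0)
  have h2 := hopt.2 _ _ ⟨interior_subset hz', interior_subset hu', h'⟩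
  rw [hgrad, map_zero] at h1
  simp only [matAct_zero, add_zero, sub_zero, _root_.zero_apply] at h1
  have h3 : ξ = 0 := by
    by_contra hne
    have := norm_pos_iff.2 hne
    nlinarith [mul_pos hκ (pow_pos this 2)]
  simp [h3, matAct_zero]

end ReducedProblem

/-! ### Equilibria of the closed loop -/

section ClosedLoop

variable {n m r nw nc q : ℕ} {S : Plant n m r nw} {O : OSSData m r nw nc}
  {Tz : Matrix (Fin r) (Fin q) ℝ} {Tu : Matrix (Fin m) (Fin q) ℝ}
  {K₁ : Matrix (Fin m) (Fin q) ℝ} {K₂ : Matrix (Fin m) (Fin nc) ℝ} {P : Matrix (Fin q) (Fin q) ℝ}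
  {τ₁ τ₂ : ℝ} {w : Vec nw}

/-- Plant equilibrium already yields `z = G_u u + G_w w`, so the integrator states only have to
enforce the engineering constraint and criticality. -/
theorem clField_eq_zero_iff (hA : IsUnit S.A) (hτ₁ : τ₁ ≠ 0) (hτ₂ : τ₂ ≠ 0)
    (p : Vec n × Vec q × Vec nc) :
    clField S O Tz Tu K₁ K₂ τ₁ τ₂ w p = 0 ↔
      S.A *ₑ p.1 + S.B *ₑ clInput K₁ K₂ p + S.Bw *ₑ w = 0 ∧
      SteadyStateConstraints S O w (clOutput S K₁ K₂ w p) (clInput K₁ K₂ p) ∧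
      reducedGradient O Tz Tu (clOutput S K₁ K₂ w p) (clInput K₁ K₂ p) 0 = 0 := by
  simp only [clField, Prod.ext_iff, Prod.fst_zero, Prod.snd_zero, neg_eq_zero, smul_eq_zero,
    inv_eq_zero, hτ₁, hτ₂, false_or, reducedGradient, matAct_zero, add_zero]
  constructor
  · rintro ⟨h1, h2, h3⟩
    exact ⟨h1, ⟨S.output_eq_of_equilibrium hA h1, h3.symm⟩, h2⟩
  · rintro ⟨h1, h2, h3⟩
    exact ⟨h1, h3, h2.2.symm⟩

theorem exists_equilibrium (hA : IsUnit S.A) (hτ₁ : τ₁ ≠ 0) (hτ₂ : τ₂ ≠ 0)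
    (hT : SpansFeasibleSubspace S O Tz Tu) (hO : StandingAssumptions S O)
    (hNK : IsUnit (constraintGain S O * K₂)) (hP : IsUnit P)
    (hK₁ : projC (constraintGain S O) K₂ * K₁ = Tu * P) {z : Vec r} {u : Vec m}
    (hopt : IsOptimal S O w z u) (hz : z ∈ interior O.Z) (hu : u ∈ interior O.U) :
    ∃ p, IsEquilibrium (clField S O Tz Tu K₁ K₂ τ₁ τ₂ w) (clDomain S O K₁ K₂ w) p ∧
      clInput K₁ K₂ p = u ∧ clOutput S K₁ K₂ w p = z := by
  obtain ⟨e, h, heh⟩ := gain_surjective hT hNK hP hK₁ u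
  let p : Vec n × Vec q × Vec nc := (-(S.A⁻¹ *ₑ (S.B *ₑ u + S.Bw *ₑ w)), e, h)
  have hpu : clInput K₁ K₂ p = u := heh
  have hx : S.A *ₑ p.1 + S.B *ₑ clInput K₁ K₂ p + S.Bw *ₑ w = 0 := by
    rw [hpu, matAct_neg, Matrix.matAct_nonsing_inv hA]
    abel
  have hpz : clOutput S K₁ K₂ w p = z := by
    rw [hopt.1.2.2.1, ← hpu]
    exact S.output_eq_of_equilibrium hA hx
  refine ⟨p, ⟨?_, (clField_eq_zero_iff hA hτ₁ hτ₂ p).2 ⟨hx, ?_, ?_⟩⟩, hpu, hpz⟩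
  · exact ⟨by rwa [hpu], by rwa [hpz]⟩
  · rw [hpu, hpz]
    exact hopt.1.2.2
  · rw [hpu, hpz]
    exact hopt.reducedGradient_eq_zero hT hO hz hu

theorem eq_of_isEquilibrium (hA : IsUnit S.A) (hτ₁ : τ₁ ≠ 0) (hτ₂ : τ₂ ≠ 0)
    (hT : SpansFeasibleSubspace S O Tz Tu) (hTrank : (Matrix.fromRows Tz Tu).rank = q)
    (hNK : IsUnit (constraintGain S O * K₂)) (hP : IsUnit P)
    (hK₁ : projC (constraintGain S O) K₂ * K₁ = Tu * P) {p p' : Vec n × Vec q × Vec nc}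
    (hp : clField S O Tz Tu K₁ K₂ τ₁ τ₂ w p = 0) (hp' : clField S O Tz Tu K₁ K₂ τ₁ τ₂ w p' = 0)
    (hu : clInput K₁ K₂ p = clInput K₁ K₂ p') : p = p' := by
  have h1 := ((clField_eq_zero_iff hA hτ₁ hτ₂ p).1 hp).1
  have h2 := ((clField_eq_zero_iff hA hτ₁ hτ₂ p').1 hp').1
  rw [← hu] at h2
  have h3 : S.A *ₑ p.1 = S.A *ₑ p'.1 := by
    linear_combination (norm := module) h1 - h2
  have h4 : p.1 = p'.1 := by
    rw [← Matrix.nonsing_inv_matAct hA p.1, h3, Matrix.nonsing_inv_matAct hA]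
  obtain ⟨h5, h6⟩ := gain_injective hT hTrank hNK hP hK₁ hu
  exact Prod.ext h4 (Prod.ext h5 h6)

end ClosedLoop

/-! ### The vector field in deviation coordinates -/

section Deviation

variable {n m r nw nc q : ℕ} {S : Plant n m r nw} {O : OSSData m r nw nc}
  {Tz : Matrix (Fin r) (Fin q) ℝ} {Tu : Matrix (Fin m) (Fin q) ℝ}
  {K₁ : Matrix (Fin m) (Fin q) ℝ} {K₂ : Matrix (Fin m) (Fin nc) ℝ} {P : Matrix (Fin q) (Fin q) ℝ}
  {τ₁ τ₂ : ℝ} {w : Vec nw}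

/-- The matrix giving the quasi-steady value of `η₂` in terms of `η₁`. -/
noncomputable def midGain (S : Plant n m r nw) (O : OSSData m r nw nc)
    (K₁ : Matrix (Fin m) (Fin q) ℝ) (K₂ : Matrix (Fin m) (Fin nc) ℝ) :
    Matrix (Fin nc) (Fin q) ℝ :=
  (constraintGain S O * K₂)⁻¹ * (constraintGain S O * K₁)

/-- Deviation of `η₂` from its quasi-steady value. -/
noncomputable abbrev midDev (S : Plant n m r nw) (O : OSSData m r nw nc)
    (K₁ : Matrix (Fin m) (Fin q) ℝ) (K₂ : Matrix (Fin m) (Fin nc) ℝ) :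
    Vec n × Vec q × Vec nc →L[ℝ] Vec nc :=
  midCoord (matCLM (midGain S O K₁ K₂))

/-- Deviation of the plant state from its quasi-steady value. -/
noncomputable abbrev fastDev (S : Plant n m r nw)
    (K₁ : Matrix (Fin m) (Fin q) ℝ) (K₂ : Matrix (Fin m) (Fin nc) ℝ) :
    Vec n × Vec q × Vec nc →L[ℝ] Vec n :=
  fastCoord (matCLM (S.A⁻¹ * S.B * K₁)) (matCLM (S.A⁻¹ * S.B * K₂))

theorem clInput_sub (s p : Vec n × Vec q × Vec nc) :
    clInput K₁ K₂ s - clInput K₁ K₂ p = clInput K₁ K₂ (s - p) := by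
  simp only [clInput, Prod.fst_sub, Prod.snd_sub, matAct_sub]
  abel

theorem clInput_eq_of_splitting (hK₁ : projC (constraintGain S O) K₂ * K₁ = Tu * P)
    (d : Vec n × Vec q × Vec nc) :
    clInput K₁ K₂ d = Tu *ₑ slowCoord (matCLM P) d + K₂ *ₑ midDev S O K₁ K₂ d :=
  gain_splitting hK₁ d.2.1 d.2.2

theorem fastDev_eq (d : Vec n × Vec q × Vec nc) :
    fastDev S K₁ K₂ d = d.1 + S.A⁻¹ *ₑ (S.B *ₑ clInput K₁ K₂ d) := by
  simp only [fastCoord_apply, matCLM_apply, clInput, matAct_mul, matAct_add]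

/-- `C x + D u = G_u u + C (x + A⁻¹ B u)`: the DC response plus the fast transient. -/
theorem clOutput_sub (s p : Vec n × Vec q × Vec nc) :
    clOutput S K₁ K₂ w s - clOutput S K₁ K₂ w p =
      S.Gu *ₑ clInput K₁ K₂ (s - p) + S.C *ₑ fastDev S K₁ K₂ (s - p) := by
  rw [fastDev_eq, ← clInput_sub]
  simp only [clOutput, Plant.Gu, matAct_add, matAct_sub, matAct_add_matrix, matAct_neg_matrix,
    matAct_mul, Prod.fst_sub]
  module

theorem clOutput_eq_of_splitting (hT : SpansFeasibleSubspace S O Tz Tu)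
    (hK₁ : projC (constraintGain S O) K₂ * K₁ = Tu * P) (s p : Vec n × Vec q × Vec nc) :
    clOutput S K₁ K₂ w s = clOutput S K₁ K₂ w p + Tz *ₑ slowCoord (matCLM P) (s - p) +
      ((S.Gu * K₂) *ₑ midDev S O K₁ K₂ (s - p) + S.C *ₑ fastDev S K₁ K₂ (s - p)) := by
  have h := clOutput_sub (S := S) (K₁ := K₁) (K₂ := K₂) (w := w) s p
  rw [clInput_eq_of_splitting (S := S) (O := O) hK₁, matAct_add, ← hT.Tz_eq] at h
  rw [matAct_mul]
  linear_combination (norm := module) h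

theorem clField_fst_eq (hA : IsUnit S.A) {p : Vec n × Vec q × Vec nc}
    (hp : clField S O Tz Tu K₁ K₂ τ₁ τ₂ w p = 0) (s : Vec n × Vec q × Vec nc) :
    (clField S O Tz Tu K₁ K₂ τ₁ τ₂ w s).1 = S.A *ₑ fastDev S K₁ K₂ (s - p) := by
  have h1 : S.A *ₑ p.1 + S.B *ₑ clInput K₁ K₂ p + S.Bw *ₑ w = 0 := congrArg Prod.fst hp
  rw [fastDev_eq, ← clInput_sub, matAct_add, Matrix.matAct_nonsing_inv hA]
  simp only [clField, Prod.fst_sub, matAct_sub]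
  linear_combination (norm := module) h1

/-- The slow coordinate drops out because `N T_u = 0`; this decouples the intermediate loop from the
optimization. -/
theorem clField_snd_snd_eq (hT : SpansFeasibleSubspace S O Tz Tu) (hτ₂ : τ₂ ≠ 0)
    (hK₁ : projC (constraintGain S O) K₂ * K₁ = Tu * P) {p : Vec n × Vec q × Vec nc}
    (hp : clField S O Tz Tu K₁ K₂ τ₁ τ₂ w p = 0) (s : Vec n × Vec q × Vec nc) :
    (clField S O Tz Tu K₁ K₂ τ₁ τ₂ w s).2.2 = -(τ₂⁻¹ •
      ((constraintGain S O * K₂) *ₑ midDev S O K₁ K₂ (s - p) +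
        (O.Hz * S.C) *ₑ fastDev S K₁ K₂ (s - p))) := by
  have h1 : O.Hz *ₑ clOutput S K₁ K₂ w p + O.Hu *ₑ clInput K₁ K₂ p + O.Hw *ₑ w = 0 := by
    have h2 : -(τ₂⁻¹ • (O.Hz *ₑ clOutput S K₁ K₂ w p + O.Hu *ₑ clInput K₁ K₂ p + O.Hw *ₑ w)) = 0 :=
      congrArg (fun x => x.2.2) hp
    exact (smul_eq_zero.1 (neg_eq_zero.1 h2)).resolve_left (inv_ne_zero hτ₂)
  have h2 : (constraintGain S O * K₂) *ₑ midDev S O K₁ K₂ (s - p) =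
      O.Hz *ₑ (S.Gu *ₑ clInput K₁ K₂ (s - p)) + O.Hu *ₑ clInput K₁ K₂ (s - p) := by
    rw [← constraintGain_matAct, clInput_eq_of_splitting (S := S) (O := O) hK₁, matAct_add,
      hT.constraintGain_Tu, zero_add, matAct_mul]
  have h3 := congrArg (fun v => O.Hz *ₑ v)
    (clOutput_sub (S := S) (K₁ := K₁) (K₂ := K₂) (w := w) s p)
  have h4 := congrArg (fun v => O.Hu *ₑ v) (clInput_sub (K₁ := K₁) (K₂ := K₂) s p)
  simp only [matAct_add, matAct_sub] at h3 h4
  simp only [clField]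
  rw [h2, matAct_mul]
  congr 2
  linear_combination (norm := module) h3 + h4 + h1

end Deviation

/-! ### Local exponential stability of the equilibrium -/

section Stability

variable {n m r nw nc q : ℕ} {S : Plant n m r nw} {O : OSSData m r nw nc}
  {Tz : Matrix (Fin r) (Fin q) ℝ} {Tu : Matrix (Fin m) (Fin q) ℝ}
  {K₁ : Matrix (Fin m) (Fin q) ℝ} {K₂ : Matrix (Fin m) (Fin nc) ℝ} {P : Matrix (Fin q) (Fin q) ℝ}
  {τ₁ τ₂ : ℝ} {w : Vec nw}

/-- The input as a continuous linear function of the state. -/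
noncomputable def clInputCLM (K₁ : Matrix (Fin m) (Fin q) ℝ) (K₂ : Matrix (Fin m) (Fin nc) ℝ) :
    Vec n × Vec q × Vec nc →L[ℝ] Vec m :=
  (matCLM K₁ ∘L ContinuousLinearMap.fst ℝ _ _ + matCLM K₂ ∘L ContinuousLinearMap.snd ℝ _ _) ∘L
    ContinuousLinearMap.snd ℝ _ _

/-- The linear part of the output as a function of the state. -/
noncomputable def clOutputCLM (S : Plant n m r nw) (K₁ : Matrix (Fin m) (Fin q) ℝ)
    (K₂ : Matrix (Fin m) (Fin nc) ℝ) : Vec n × Vec q × Vec nc →L[ℝ] Vec r :=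
  matCLM S.C ∘L ContinuousLinearMap.fst ℝ _ _ + matCLM S.D ∘L clInputCLM K₁ K₂

theorem continuous_clInput :
    Continuous fun s : Vec n × Vec q × Vec nc => clInput K₁ K₂ s :=
  (clInputCLM (n := n) K₁ K₂).continuous

theorem continuous_clOutput : Continuous fun s : Vec n × Vec q × Vec nc =>
    clOutput S K₁ K₂ w s :=
  (clOutputCLM S K₁ K₂).continuous.add continuous_const

open NNReal in
theorem exists_lipschitzOnWith_clField {B : Set (Vec n × Vec q × Vec nc)} {L : ℝ≥0}
    {Bz : Set (Vec r)} {Bu : Set (Vec m)} (hLz : LipschitzOnWith L (gradient O.g₀) Bz)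
    (hLu : LipschitzOnWith L (gradient O.f₀) Bu) (hz : Set.MapsTo (clOutput S K₁ K₂ w) B Bz)
    (hu : Set.MapsTo (clInput K₁ K₂) B Bu) :
    ∃ K : ℝ≥0, LipschitzOnWith K (clField S O Tz Tu K₁ K₂ τ₁ τ₂ w) B := by
  have hul : LipschitzOnWith _ (clInput K₁ K₂) B :=
    (clInputCLM (n := n) K₁ K₂).lipschitz.lipschitzOnWith
  have hzl : LipschitzOnWith _ (clOutput S K₁ K₂ w) B :=
    ((clOutputCLM S K₁ K₂).lipschitz.add (LipschitzWith.const (S.Dw *ₑ w))).lipschitzOnWith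
  have h1 : LipschitzOnWith _ (fun s : Vec n × Vec q × Vec nc =>
      S.A *ₑ s.1 + S.B *ₑ clInput K₁ K₂ s + S.Bw *ₑ w) B :=
    ((((matCLM S.A).lipschitz.comp LipschitzWith.prod_fst).lipschitzOnWith).add
      ((matCLM S.B).lipschitz.comp_lipschitzOnWith hul)).add
      (LipschitzWith.const (S.Bw *ₑ w)).lipschitzOnWith
  have h2 : LipschitzOnWith _ (fun s : Vec n × Vec q × Vec nc =>
      -(τ₁⁻¹ • (Tuᵀ *ₑ gradient O.f₀ (clInput K₁ K₂ s) +
        Tzᵀ *ₑ gradient O.g₀ (clOutput S K₁ K₂ w s)))) B :=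
    (-(τ₁⁻¹ • ContinuousLinearMap.id ℝ (Vec q))).lipschitz.comp_lipschitzOnWith
      (((matCLM Tuᵀ).lipschitz.comp_lipschitzOnWith (hLu.comp hul hu)).add
        ((matCLM Tzᵀ).lipschitz.comp_lipschitzOnWith (hLz.comp hzl hz)))
  have h3 : LipschitzOnWith _ (fun s : Vec n × Vec q × Vec nc =>
      -(τ₂⁻¹ • (O.Hz *ₑ clOutput S K₁ K₂ w s + O.Hu *ₑ clInput K₁ K₂ s + O.Hw *ₑ w))) B :=
    (-(τ₂⁻¹ • ContinuousLinearMap.id ℝ (Vec nc))).lipschitz.comp_lipschitzOnWith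
      ((((matCLM O.Hz).lipschitz.comp_lipschitzOnWith hzl).add
        ((matCLM O.Hu).lipschitz.comp_lipschitzOnWith hul)).add
        (LipschitzWith.const (O.Hw *ₑ w)).lipschitzOnWith)
  exact ⟨_, h1.prodMk (h2.prodMk h3)⟩

end Stability

section Stability

variable {n m r nw nc q : ℕ} {S : Plant n m r nw} {O : OSSData m r nw nc}
  {Tz : Matrix (Fin r) (Fin q) ℝ} {Tu : Matrix (Fin m) (Fin q) ℝ}
  {K₁ : Matrix (Fin m) (Fin q) ℝ} {K₂ : Matrix (Fin m) (Fin nc) ℝ} {P : Matrix (Fin q) (Fin q) ℝ}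
  {τ₁ τ₂ : ℝ} {w : Vec nw}

open NNReal in
/-- Bound for the change of the gradient direction caused by deviations of the faster variables
from their quasi-steady values, for gradients with Lipschitz constant `L`. -/
noncomputable def perturbationGain (S : Plant n m r nw) (Tz : Matrix (Fin r) (Fin q) ℝ)
    (Tu : Matrix (Fin m) (Fin q) ℝ) (K₂ : Matrix (Fin m) (Fin nc) ℝ) (L : ℝ≥0) : ℝ :=
  L * (‖matCLM Tuᵀ‖ * ‖matCLM K₂‖ + ‖matCLM Tzᵀ‖ * (‖matCLM (S.Gu * K₂)‖ + ‖matCLM S.C‖))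

open NNReal in
theorem perturbationGain_nonneg (L : ℝ≥0) : 0 ≤ perturbationGain S Tz Tu K₂ L := by
  unfold perturbationGain
  positivity

open NNReal in
theorem norm_gradient_perturbation_le {L : ℝ≥0} {Bz : Set (Vec r)} {Bu : Set (Vec m)}
    (hLz : LipschitzOnWith L (gradient O.g₀) Bz) (hLu : LipschitzOnWith L (gradient O.f₀) Bu)
    {z : Vec r} {u : Vec m} {a : Vec nc} {b : Vec n} (hu : u ∈ Bu) (hz : z ∈ Bz)
    (hu' : u + K₂ *ₑ a ∈ Bu) (hz' : z + ((S.Gu * K₂) *ₑ a + S.C *ₑ b) ∈ Bz) :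
    ‖(Tuᵀ *ₑ gradient O.f₀ (u + K₂ *ₑ a) +
        Tzᵀ *ₑ gradient O.g₀ (z + ((S.Gu * K₂) *ₑ a + S.C *ₑ b))) -
      (Tuᵀ *ₑ gradient O.f₀ u + Tzᵀ *ₑ gradient O.g₀ z)‖ ≤
      perturbationGain S Tz Tu K₂ L * (‖a‖ + ‖b‖) := by
  have ha := norm_nonneg a
  have hb := norm_nonneg b
  have h1 : ‖gradient O.f₀ (u + K₂ *ₑ a) - gradient O.f₀ u‖ ≤
      L * (‖matCLM K₂‖ * (‖a‖ + ‖b‖)) := by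
    have := hLu.dist_le_mul _ hu' _ hu
    rw [dist_eq_norm, dist_eq_norm, add_sub_cancel_left] at this
    refine this.trans ?_
    gcongr
    refine (matAct_norm_le K₂ a).trans ?_
    gcongr
    linarith
  have h2 : ‖gradient O.g₀ (z + ((S.Gu * K₂) *ₑ a + S.C *ₑ b)) - gradient O.g₀ z‖ ≤
      L * ((‖matCLM (S.Gu * K₂)‖ + ‖matCLM S.C‖) * (‖a‖ + ‖b‖)) := by
    have := hLz.dist_le_mul _ hz' _ hz
    rw [dist_eq_norm, dist_eq_norm, add_sub_cancel_left] at this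
    refine this.trans ?_
    gcongr
    refine (norm_add_le _ _).trans ?_
    have h3 := matAct_norm_le (S.Gu * K₂) a
    have h4 := matAct_norm_le S.C b
    have h5 : 0 ≤ ‖matCLM (S.Gu * K₂)‖ * ‖b‖ := by positivity
    have h6 : 0 ≤ ‖matCLM S.C‖ * ‖a‖ := by positivity
    linarith
  rw [add_sub_add_comm, ← matAct_sub, ← matAct_sub]
  refine (norm_add_le _ _).trans ?_
  calc _ ≤ ‖matCLM Tuᵀ‖ * (L * (‖matCLM K₂‖ * (‖a‖ + ‖b‖))) +
        ‖matCLM Tzᵀ‖ * (L * ((‖matCLM (S.Gu * K₂)‖ + ‖matCLM S.C‖) * (‖a‖ + ‖b‖))) := by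
        refine add_le_add ((matAct_norm_le _ _).trans ?_) ((matAct_norm_le _ _).trans ?_)
        · gcongr
        · gcongr
    _ = _ := by
        unfold perturbationGain
        ring

-- The dissipation inequality is a hypothesis because the time constants are fixed before `w`; only
-- the radius of the ball and the stability constants are chosen here, for one equilibrium.
open NNReal Metric Filter Topology in
theorem isLocallyExpStable_closedLoop {p : Vec n × Vec q × Vec nc} {L : ℝ≥0} (hA : IsUnit S.A)
    (hτ₁ : 0 < τ₁) (hτ₂ : 0 < τ₂) (hT : SpansFeasibleSubspace S O Tz Tu)
    (hO : StandingAssumptions S O) (hP : IsUnit P)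
    (hK₁ : projC (constraintGain S O) K₂ * K₁ = Tu * P)
    (hp : clField S O Tz Tu K₁ K₂ τ₁ τ₂ w p = 0)
    (hreg : IsRegularOptimal S O L w (clOutput S K₁ K₂ w p) (clInput K₁ K₂ p))
    {κ : ℝ} (hκ : 0 < κ)
    (hconv : StrongConvexOn {ξ : Vec q | clInput K₁ K₂ p + Tu *ₑ ξ ∈ O.U ∧
        clOutput S K₁ K₂ w p + Tz *ₑ ξ ∈ O.Z} κ
      (fun ξ => O.f₀ (clInput K₁ K₂ p + Tu *ₑ ξ) + O.g₀ (clOutput S K₁ K₂ w p + Tz *ₑ ξ)))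
    {Q₂ : Vec nc →L[ℝ] Vec nc} {Q₃ : Vec n →L[ℝ] Vec n}
    (hQ₂ : ∀ v v', inner ℝ (Q₂ v) v' = inner ℝ v (Q₂ v')) {c₂ : ℝ} (hc₂ : 0 < c₂)
    (hQ₂' : ∀ v, c₂ * ‖v‖ ^ 2 ≤ inner ℝ (Q₂ v) v)
    (hQ₃ : ∀ v v', inner ℝ (Q₃ v) v' = inner ℝ v (Q₃ v')) {c₃ : ℝ} (hc₃ : 0 < c₃)
    (hQ₃' : ∀ v, c₃ * ‖v‖ ^ 2 ≤ inner ℝ (Q₃ v) v) {μ : ℝ} (hμ : 0 < μ)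
    (hdiss : ∀ (g r : Vec q) (a : Vec nc) (b : Vec n),
      ‖r‖ ≤ perturbationGain S Tz Tu K₂ L * (‖a‖ + ‖b‖) → ∀ (F₁ : Vec q) (F₂ : Vec nc),
      F₁ = -(τ₁⁻¹ • (g + r)) →
      F₂ = -(τ₂⁻¹ • (matCLM (constraintGain S O * K₂) a + matCLM (O.Hz * S.C) b)) →
      inner ℝ g (matCLM P F₁) + 2 * inner ℝ (Q₂ a) (F₂ + matCLM (midGain S O K₁ K₂) F₁) +
        2 * inner ℝ (Q₃ b) (matCLM S.A b + matCLM (S.A⁻¹ * S.B * K₁) F₁ +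
          matCLM (S.A⁻¹ * S.B * K₂) F₂) ≤
      -(μ * τ₁⁻¹ * ‖g‖ ^ 2 + τ₂⁻¹ * ‖a‖ ^ 2 + ‖b‖ ^ 2) / 4) :
    IsLocallyExpStable (clField S O Tz Tu K₁ K₂ τ₁ τ₂ w) (clDomain S O K₁ K₂ w) p := by
  obtain ⟨hopt, R₀, hR₀, hBz, hBu, hLz, hLu⟩ := hreg
  set u := clInput K₁ K₂ p with hu
  set z := clOutput S K₁ K₂ w p with hz
  let G : Vec q → Vec q := reducedGradient O Tz Tu z u
  have hcu : Continuous fun ξ : Vec q => u + Tu *ₑ ξ :=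
    continuous_const.add (matCLM Tu).continuous
  have hcz : Continuous fun ξ : Vec q => z + Tz *ₑ ξ :=
    continuous_const.add (matCLM Tz).continuous
  have hu0 : u + Tu *ₑ (0 : Vec q) = u := by rw [matAct_zero, add_zero]
  have hz0 : z + Tz *ₑ (0 : Vec q) = z := by rw [matAct_zero, add_zero]
  obtain ⟨R₁, hR₁, hball₁⟩ := Metric.eventually_nhds_iff_ball.1
    ((hcu.continuousAt.eventually (ball_mem_nhds (u + Tu *ₑ (0 : Vec q)) hR₀)).and
      (hcz.continuousAt.eventually (ball_mem_nhds (z + Tz *ₑ (0 : Vec q)) hR₀)))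
  rw [hu0, hz0] at hball₁
  have hslow : Continuous fun s : Vec n × Vec q × Vec nc => slowCoord (matCLM P) (s - p) :=
    (slowCoord (matCLM P)).continuous.comp (continuous_id.sub continuous_const)
  -- Both the actual pair `(u, z)` and its quasi-steady counterpart at `ξ` must lie where the
  -- gradients are Lipschitz; `R₁` takes care of the latter.
  obtain ⟨R, hR, hball⟩ := Metric.eventually_nhds_iff_ball.1
    (((continuous_clInput (K₁ := K₁) (K₂ := K₂)).continuousAt.eventually
      (ball_mem_nhds (clInput K₁ K₂ p) hR₀)).and
    (((continuous_clOutput (S := S) (K₁ := K₁) (K₂ := K₂) (w := w)).continuousAt.eventually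
      (ball_mem_nhds (clOutput S K₁ K₂ w p) hR₀)).and
    (hslow.continuousAt.eventually (ball_mem_nhds (slowCoord (matCLM P) (p - p)) hR₁))))
  rw [sub_self, map_zero, ← hu, ← hz] at hball
  obtain ⟨K, hK⟩ := exists_lipschitzOnWith_clField (S := S) (O := O) (Tz := Tz) (Tu := Tu)
    (K₁ := K₁) (K₂ := K₂) (τ₁ := τ₁) (τ₂ := τ₂) (w := w) (B := ball p R) hLz hLu
    (fun s hs => (hball s hs).2.1) (fun s hs => (hball s hs).1)
  have hGd : ∀ ξ ∈ ball (0 : Vec q) R₁,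
      HasFDerivAt (fun ξ : Vec q => O.f₀ (u + Tu *ₑ ξ) + O.g₀ (z + Tz *ₑ ξ))
        (innerSL ℝ (G ξ)) ξ := fun ξ hξ =>
    hO.hasFDerivAt_reduced (hBu (hball₁ ξ hξ).1) (hBz (hball₁ ξ hξ).2)
  have hG0 : G 0 = 0 := ((clField_eq_zero_iff hA hτ₁.ne' hτ₂.ne' p).1 hp).2.2
  obtain ⟨L', hGL⟩ : ∃ L' : ℝ≥0, LipschitzOnWith L' G (ball 0 R₁) := by
    have h1 : LipschitzOnWith _ (fun ξ : Vec q => u + Tu *ₑ ξ) (ball 0 R₁) :=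
      ((LipschitzWith.const u).add (matCLM Tu).lipschitz).lipschitzOnWith
    have h2 : LipschitzOnWith _ (fun ξ : Vec q => z + Tz *ₑ ξ) (ball 0 R₁) :=
      ((LipschitzWith.const z).add (matCLM Tz).lipschitz).lipschitzOnWith
    exact ⟨_, ((matCLM Tuᵀ).lipschitz.comp_lipschitzOnWith
      (hLu.comp h1 fun ξ hξ => (hball₁ ξ hξ).1)).add
      ((matCLM Tzᵀ).lipschitz.comp_lipschitzOnWith (hLz.comp h2 fun ξ hξ => (hball₁ ξ hξ).2))⟩
  have hbounds := fun ξ (hξ : ξ ∈ ball (0 : Vec q) R₁) => hconv.bounds_near_critical hR₁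
    (fun ξ hξ => ⟨interior_subset (hBu (hball₁ ξ hξ).1), interior_subset (hBz (hball₁ ξ hξ).2)⟩)
    hGd hG0 hGL hξ
  have hτ₁' : 0 < τ₁⁻¹ := inv_pos.2 hτ₁
  have hτ₂' : 0 < τ₂⁻¹ := inv_pos.2 hτ₂
  refine isLocallyExpStable_of_three_timescale_dissipation hR
    (fun s hs => ⟨hBu (hball s hs).1, hBz (hball s hs).2.1⟩) hK (P := matCLM P) ?_
    (matCLM (midGain S O K₁ K₂)) (matCLM (S.A⁻¹ * S.B * K₁)) (matCLM (S.A⁻¹ * S.B * K₂))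
    hQ₂ hc₂ hQ₂' hQ₃ hc₃ hQ₃' (G := G) (ℓ := L') hκ
    (fun s hs => hGd _ (hball s hs).2.2) (fun s hs => (hbounds _ (hball s hs).2.2).1)
    (fun s hs => ?_) (fun s hs => (hbounds _ (hball s hs).2.2).2.2)
    (k₁ := μ * τ₁⁻¹ / 4) (k₂ := τ₂⁻¹ / 4) (k₃ := 1 / 4) (by positivity) (by positivity)
    (by positivity) (fun s hs => ?_)
  · intro v v' hv
    have h1 := congrArg (fun x => P⁻¹ *ₑ x) hv
    simpa only [matCLM_apply, Matrix.nonsing_inv_matAct hP] using h1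
  · obtain ⟨h1, h2, -⟩ := hbounds _ (hball s hs).2.2
    have h3 : 0 ≤ κ / 2 * ‖slowCoord (matCLM P) (s - p)‖ ^ 2 := by positivity
    linarith
  · obtain ⟨hsu, hsz, hsξ⟩ := hball s hs
    set ξ := slowCoord (matCLM P) (s - p) with hξ
    set a := midDev S O K₁ K₂ (s - p) with ha
    set b := fastDev S K₁ K₂ (s - p) with hb
    have hus : clInput K₁ K₂ s = u + Tu *ₑ ξ + K₂ *ₑ a := by
      have h1 := clInput_sub (K₁ := K₁) (K₂ := K₂) s p
      rw [clInput_eq_of_splitting (S := S) (O := O) hK₁ (s - p)] at h1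
      linear_combination (norm := module) h1
    have hzs := clOutput_eq_of_splitting (w := w) hT hK₁ s p
    rw [hus] at hsu
    rw [hzs] at hsz
    have hr := norm_gradient_perturbation_le (Tz := Tz) (Tu := Tu) hLz hLu (hball₁ ξ hsξ).1
      (hball₁ ξ hsξ).2 hsu hsz
    -- The slow field is the reduced gradient at the quasi-steady point plus the perturbation
    -- bounded in `hr`.
    have hF₁ : (clField S O Tz Tu K₁ K₂ τ₁ τ₂ w s).2.1 = -(τ₁⁻¹ • (G ξ +
        ((Tuᵀ *ₑ gradient O.f₀ (u + Tu *ₑ ξ + K₂ *ₑ a) +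
        Tzᵀ *ₑ gradient O.g₀ (z + Tz *ₑ ξ + ((S.Gu * K₂) *ₑ a + S.C *ₑ b))) -
        (Tuᵀ *ₑ gradient O.f₀ (u + Tu *ₑ ξ) + Tzᵀ *ₑ gradient O.g₀ (z + Tz *ₑ ξ))))) := by
      simp only [G, reducedGradient, add_sub_cancel]
      rw [← hus, ← hzs]
      rfl
    have hF₂ := clField_snd_snd_eq (τ₁ := τ₁) hT hτ₂.ne' hK₁ hp s
    have hF₃ := clField_fst_eq hA hp s
    have hd := hdiss (G ξ) _ a b hr _ _ hF₁ hF₂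
    rw [slowCoord_apply, midCoord_apply, fastCoord_apply, hF₃, ← add_assoc]
    refine le_trans hd (le_of_eq ?_)
    ring

end Stability

/-! ### Choice of the time constants and conclusion -/

theorem theorem2 {n m r nw nc q : ℕ} (S : Plant n m r nw) (O : OSSData m r nw nc)
    (hA : IsHurwitz S.A) (hO : StandingAssumptions S O)
    (Tz : Matrix (Fin r) (Fin q) ℝ) (Tu : Matrix (Fin m) (Fin q) ℝ)
    (hT : SpansFeasibleSubspace S O Tz Tu)
    (hTrank : (Matrix.fromRows Tz Tu).rank = q)
    (hN : (constraintGain S O).rank = nc)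
    (z₀ : Vec nw → Vec r) (u₀ : Vec nw → Vec m)
    (h₀ : ∀ w ∈ O.W, SteadyStateConstraints S O w (z₀ w) (u₀ w))
    (hconv : ∀ w ∈ O.W, ∃ κ : ℝ, 0 < κ ∧
      StrongConvexOn {ξ : Vec q | Tu *ₑ ξ + u₀ w ∈ O.U ∧ Tz *ₑ ξ + z₀ w ∈ O.Z} κ
        (fun ξ => O.f₀ (Tu *ₑ ξ + u₀ w) + O.g₀ (Tz *ₑ ξ + z₀ w))) :
    (∃ K₂ : Matrix (Fin m) (Fin nc) ℝ, IsHurwitz (-(constraintGain S O * K₂))) ∧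
    ∀ K₂ : Matrix (Fin m) (Fin nc) ℝ, IsHurwitz (-(constraintGain S O * K₂)) →
      ∀ P : Matrix (Fin q) (Fin q) ℝ, P.PosDef →
        (∃ K₁ : Matrix (Fin m) (Fin q) ℝ,
          K₁.rank = q ∧ projC (constraintGain S O) K₂ * K₁ = Tu * P) ∧
        ∀ K₁ : Matrix (Fin m) (Fin q) ℝ, K₁.rank = q →
          projC (constraintGain S O) K₂ * K₁ = Tu * P →
          ∃ τstar > (0 : ℝ), ∃ ρ > (0 : ℝ), ∀ τ₁ τ₂ : ℝ, τstar < τ₂ → ρ * τ₂ < τ₁ →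
            SolvesOSS S O Tz Tu K₁ K₂ τ₁ τ₂ := by
  refine ⟨exists_stabilizing_gain hN, fun K₂ hK₂ P hP =>
    ⟨exists_slow_gain hT hTrank hP.isUnit, fun K₁ _ hK₁ => ?_⟩⟩
  have hAu : IsUnit S.A := hA.isUnit
  have hNK : IsUnit (constraintGain S O * K₂) := by simpa using hK₂.isUnit
  obtain ⟨L, hL⟩ := hO.exists_uniform_lipschitz hT hN z₀ u₀ h₀ hconv
  obtain ⟨Q₂, hQ₂, ⟨c₂, hc₂, hQ₂'⟩, hQ₂l⟩ := hK₂.exists_lyapunov_form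
  obtain ⟨Q₃, hQ₃, ⟨c₃, hc₃, hQ₃'⟩, hQ₃l⟩ := hA.exists_lyapunov_form
  obtain ⟨μ, hμ, hPμ⟩ := hP.exists_mul_norm_sq_le_inner
  -- The thresholds are fixed here, before `w` is introduced; the perturbation bound uses the
  -- uniform `L`.
  obtain ⟨τs, hτs, ρ, hρ, hdiss⟩ := three_timescale_dissipation (P := matCLM P) hμ hPμ
    (matCLM (midGain S O K₁ K₂)) (matCLM (S.A⁻¹ * S.B * K₁)) (matCLM (S.A⁻¹ * S.B * K₂))
    (matCLM (constraintGain S O * K₂)) (matCLM (O.Hz * S.C)) (matCLM S.A) Q₂ Q₃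
    (fun v => by
      have h1 := hQ₂l v
      rw [matAct_neg_matrix, inner_neg_right] at h1
      rw [matCLM_apply]
      linarith)
    hQ₃l (perturbationGain_nonneg (S := S) (Tz := Tz) (Tu := Tu) (K₂ := K₂) L)
  refine ⟨τs, hτs, ρ, hρ, fun τ₁ τ₂ hτ₂ hτ₁ w hw => ?_⟩
  have hτ₂0 : 0 < τ₂ := hτs.trans hτ₂
  have hτ₁0 : 0 < τ₁ := (mul_pos hρ hτ₂0).trans hτ₁
  have he₂ : τ₂⁻¹ * τs < 1 := by
    rw [inv_mul_lt_iff₀ hτ₂0, mul_one]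
    exact hτ₂
  have he₁ : ρ * τ₁⁻¹ < τ₂⁻¹ := by
    rw [← div_eq_mul_inv, div_lt_iff₀ hτ₁0, inv_mul_eq_div, lt_div_iff₀ hτ₂0]
    exact hτ₁
  obtain ⟨z, u, hreg⟩ := hL w hw
  have hreg' := hreg
  obtain ⟨hopt, R, hR, hz, hu, -, -⟩ := hreg'
  obtain ⟨κ, hκ, hκc⟩ := hconv w hw
  obtain ⟨p, hp, rfl, rfl⟩ := exists_equilibrium (w := w) hAu hτ₁0.ne' hτ₂0.ne' hT hO hNK
    hP.isUnit hK₁ hopt (hz (Metric.mem_ball_self hR)) (hu (Metric.mem_ball_self hR))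
  refine ⟨p, hp, fun p' hp' => ?_, ?_, hopt⟩
  · obtain ⟨-, hss, hgrad⟩ := (clField_eq_zero_iff hAu hτ₁0.ne' hτ₂0.ne' p').1 hp'.2
    have h1 := eq_of_reducedGradient_eq_zero hT hO hopt hp'.1.2 hp'.1.1 hss hgrad hκ
      ((h₀ w hw).strongConvexOn hT hss hκc)
    exact eq_of_isEquilibrium hAu hτ₁0.ne' hτ₂0.ne' hT hTrank hNK hP.isUnit hK₁ hp'.2 hp.2 h1.2
  · exact isLocallyExpStable_closedLoop hAu hτ₁0 hτ₂0 hT hO hP.isUnit hK₁ hp.2 hreg hκ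
      ((h₀ w hw).strongConvexOn hT hopt.1.2.2 hκc) hQ₂ hc₂ hQ₂' hQ₃ hc₃ hQ₃' hμ
      (hdiss _ _ (inv_pos.2 hτ₁0) (inv_pos.2 hτ₂0) he₂ he₁)
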